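/- Let $p$ be a prime, $r\ge 1$, and $\mathbb{Z}_{p^r}$ the ring of integers modulo $p^r$. For $a\in\mathbb{Z}_{p^r}$ and $0\le s\le r$ let $[a]_s\in\{0,\dots,p^s-1\}$ be the representative of the coset $a+p^s\mathbb{Z}_{p^r}$. For a probability mass function $P$ on a finite set $\mathcal{A}$ and $\epsilon>0$, a sequence $\mathbf{x}\in\mathcal{A}^n$ is $\epsilon$-typical if $\big|\tfrac1n N(a|\mathbf{x})-P(a)\big|\le \epsilon/|\mathcal{A}|$ for all $a\in\mathcal{A}$, where $N(a|\mathbf{x})$ is the number of occurrences of $a$ in $\mathbf{x}$, and no $a$ with $P(a)=0$ occurs in $\mathbf{x}$; $A_\epsilon^{(n)}$ denotes the set of such sequences. Entropies are in bits. Let $\mathcal{Q}$ and $\mathcal{X}$ be finite sets, let $(U,Q)$ be a pair of random variables on $\mathbb{Z}_{p^r}\times\mathcal{Q}$ with $P_Q(q)>0$ for all $q\in\mathcal{Q}$ and $H([U]_s|Q)>0$ for $1\le s\le r$, let $(X,\hat X)\sim P_{X\hat X}$ take values in $\mathcal{X}\times\mathbb{Z}_{p^r}$, and let $c>0$. There is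 a function $\eta$ with $\eta(\epsilon)\to0$ as $\epsilon\downarrow0$ such that for all $\epsilon>0$ and $\delta>0$ there is an $N$ such that the following holds for every $n>N$. Let $k_q$, $q\in\mathcal{Q}$, be nonnegative integers with $|k_q-P_Q(q)\,cn|<1$ (so that $k_q=P_Q(q)\,cn$ up to rounding), put $k=\sum_q k_q$, and let $\mathcal{U}_n=\prod_{q\in\mathcal{Q}}A_\epsilon^{(k_q)}(U_q)\subseteq\mathbb{Z}_{p^r}^{k}$, where $U_q$ has the law of $U$ given $Q=q$. Let $\mathcal{C}_n=\{\mathbf{u}\mathbf{G}+\mathbf{b}:\mathbf{u}\in\mathcal{U}_n\}$ be the random $(n,k)$ quasi group code in which the entries of the $k\times n$ matrix $\mathbf{G}$ and of $\mathbf{b}\in\mathbb{Z}_{p^r}^n$ are independent and uniform on $\mathbb{Z}_{p^r}$, and let $\mathbf{X}^n$, independent of $(\mathbf{G},\mathbf{b})$, have law $\prod_{i=1}^nP_X$. If $$R_n>\max_{1\le s\le r}\frac{H(U|Q)}{H([U]_s|Q)}\Big(\log_2p^s-H([\hat X]_s|X)+\eta(\epsilon)\Big),$$ then $$P\big\{\exists\,\hat{\mathbf{x}}\in\mathcal{C}_n:(\mathbf{X}^n,\hat{\mathbf{x}})\in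 A_\epsilon^{(n)}(X,\hat X)\big\}>1-\delta .$$ Here $R_n$ may be taken to be either $\frac1n\log_2|\mathcal{U}_n|$ or the rate $\frac1n\log_2|\mathcal{C}_n|$ of any one realization of the random code $\mathcal{C}_n$. -/

import Mathlib

/-! Probability mass functions on a finite type `α` are vectors `P : α → ℝ` in `stdSimplex ℝ α`. -/

namespace QGC

noncomputable section

/-- The law of the random variable `f` when the underlying outcome has probability mass
function `P`. -/
def law {Ω α : Type*} [Fintype Ω] [DecidableEq α] (P : Ω → ℝ) (f : Ω → α) (a : α) : ℝ :=
  ∑ ω with f ω = a, P ω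

/-- The conditional entropy `H(V | W)` in bits, for random variables `V`, `W` on a finite
probability space with probability mass function `P`. Pairs of probability zero contribute zero. -/
def condEntropy {Ω α β : Type*} [Fintype Ω] [Fintype α] [DecidableEq α] [Fintype β]
    [DecidableEq β] (P : Ω → ℝ) (V : Ω → α) (W : Ω → β) : ℝ :=
  -∑ a, ∑ b, law P (fun ω => (V ω, W ω)) (a, b) *
    Real.logb 2 (law P (fun ω => (V ω, W ω)) (a, b) / law P W b)

/-- `[a]_s`: the representative in `{0, …, p ^ s - 1}` of the coset of `a` modulo the subgroup
`p ^ s ℤ_{p ^ r}`. -/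
def cosetRep (p r s : ℕ) (a : ZMod (p ^ r)) : ZMod (p ^ r) :=
  ((a.val % p ^ s : ℕ) : ZMod (p ^ r))

/-- The number of occurrences of the letter `a` in the sequence `x`. -/
def occurrences {α : Type*} [DecidableEq α] {n : ℕ} (a : α) (x : Fin n → α) : ℕ :=
  (Finset.univ.filter fun i => x i = a).card

/-- `ε`-typicality of a sequence with respect to the probability mass function `P`. -/
def IsTypical {α : Type*} [Fintype α] [DecidableEq α] (P : α → ℝ) (ε : ℝ) {n : ℕ}
    (x : Fin n → α) : Prop :=
  (∀ a, |(occurrences a x : ℝ) / n - P a| ≤ ε / Fintype.card α) ∧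
    ∀ a, P a = 0 → ∀ i, x i ≠ a

/-- Joint `ε`-typicality of a pair of sequences. -/
def JointlyTypical {α β : Type*} [Fintype α] [DecidableEq α] [Fintype β] [DecidableEq β]
    (P : α × β → ℝ) (ε : ℝ) {n : ℕ} (x : Fin n → α) (y : Fin n → β) : Prop :=
  IsTypical P ε fun i => (x i, y i)

/-- The conditional probability mass function of the first coordinate given that the second
coordinate equals `q`. -/
def condLaw {α Q : Type*} [Fintype α] [Fintype Q] [DecidableEq Q] (P : α × Q → ℝ) (q : Q)
    (a : α) : ℝ :=
  P (a, q) / law P Prod.snd q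

/-- The index set: the Cartesian product over `q` of the `ε`-typical sets of length `k q` of the
conditional laws of `U` given `Q = q`. An element is a vector with `∑ q, k q` coordinates,
arranged in blocks labelled by `q`. -/
def indexSet {m : ℕ} [NeZero m] {Q : Type*} [Fintype Q] [DecidableEq Q] (P : ZMod m × Q → ℝ)
    (ε : ℝ) (k : Q → ℕ) : Set ((Σ q, Fin (k q)) → ZMod m) :=
  {u | ∀ q, IsTypical (condLaw P q) ε fun j => u ⟨q, j⟩}

/-- The quasi group code `{u G + b : u ∈ 𝒰}`, where `𝒰` is the index set. -/
def code {m : ℕ} [NeZero m] {Q : Type*} [Fintype Q] [DecidableEq Q] (P : ZMod m × Q → ℝ)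
    (ε : ℝ) (k : Q → ℕ) {n : ℕ} (G : Matrix (Σ q, Fin (k q)) (Fin n) (ZMod m))
    (b : Fin n → ZMod m) : Set (Fin n → ZMod m) :=
  {y | ∃ u ∈ indexSet P ε k, y = Matrix.vecMul u G + b}

/-- `(1 / n) log₂ |S|`, the rate of a set `S` at block length `n`. -/
def rate {α : Type*} (n : ℕ) (S : Set α) : ℝ :=
  Real.logb 2 (S.ncard : ℝ) / n

/-- The probability mass function of `(𝐗, G, b)`, where `𝐗` is i.i.d. with law `PX`, the matrix
`G` and the translation `b` have uniform entries, and everything is independent. -/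
def ensembleLaw {m : ℕ} [NeZero m] {Q X : Type*} [Fintype Q] [DecidableEq Q] (PX : X → ℝ)
    (k : Q → ℕ) (n : ℕ)
    (ω : (Fin n → X) × Matrix (Σ q, Fin (k q)) (Fin n) (ZMod m) × (Fin n → ZMod m)) : ℝ :=
  (∏ i, PX (ω.1 i)) *
    (1 / (Fintype.card (Matrix (Σ q, Fin (k q)) (Fin n) (ZMod m)) : ℝ)) *
    (1 / (Fintype.card (Fin n → ZMod m) : ℝ))

/-- The probability that the random code contains a codeword that is jointly `ε`-typical with
the random source sequence `𝐗`. -/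
def coverProb {m : ℕ} [NeZero m] {Q X : Type*} [Fintype Q] [DecidableEq Q] [Fintype X]
    [DecidableEq X] (PUQ : ZMod m × Q → ℝ) (PXX : X × ZMod m → ℝ) (ε : ℝ) (k : Q → ℕ)
    (n : ℕ) : ℝ :=
  ∑ ω : (Fin n → X) × Matrix (Σ q, Fin (k q)) (Fin n) (ZMod m) × (Fin n → ZMod m),
    Set.indicator {ω | ∃ y ∈ code PUQ ε k ω.2.1 ω.2.2, JointlyTypical PXX ε ω.1 y}
      (ensembleLaw (law PXX Prod.fst) k n) ω

/-- The `s`-th expression of the covering bound,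
`(H(U|Q) / H([U]_s|Q)) * (log₂ p ^ s - H([X̂]_s|X) + e)`. -/
def coveringBound {p r : ℕ} [NeZero (p ^ r)] {Q X : Type*} [Fintype Q] [DecidableEq Q]
    [Fintype X] [DecidableEq X] (PUQ : ZMod (p ^ r) × Q → ℝ) (PXX : X × ZMod (p ^ r) → ℝ)
    (e : ℝ) (s : ℕ) : ℝ :=
  condEntropy PUQ Prod.fst Prod.snd /
      condEntropy PUQ (fun ω => cosetRep p r s ω.1) Prod.snd *
    (Real.logb 2 ((p : ℝ) ^ s) - condEntropy PXX (fun ω => cosetRep p r s ω.2) Prod.fst + e)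

end

end QGC

namespace QGC

open Finset

/-! The proof is a second moment argument. Fix a source sequence `x`, let `T` be the set of
sequences jointly typical with `x`, and count the indices `u` in the index set `U` with `u G + b ∈
T`. Since `b` is uniform, each `u` succeeds with probability `|T| / p ^ (r n)`. For a pair `u, u'`,
let `p ^ s` be the largest power with `s ≤ r` dividing `u' - u`. Some coordinate is then a unit
times `p ^ s` (or `s = r`), so `(u' - u) G` takes each value with probability at most `p ^ (-(r - s)
n)`, and the two codewords agree modulo `p ^ s` (`exists_card_pair_mul_le`).

Grouping pairs by `s`, the level `s = 0` contributes at most the squared mean, so Chebyshev bounds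
the probability of missing `T` by the sum over `1 ≤ s ≤ r` of `p ^ (s n)` times the largest
proportion of `U`, and of `T`, lying in one class modulo `p ^ s` (`card_miss_div_le`). Up to `O(ε)`
in the exponent these proportions are at most `2 ^ (-n c H([U]_s|Q))`
(`exists_indexSet_card_bounds`) and, for most `x`, `2 ^ (-n H([X̂]_s|X))`
(`exists_slice_card_bounds`). Both come from typicality: fibres are counted from above by weighing
sequences with conditional probabilities, the whole set from below by the law of large numbers, and
the chain rule identifies the exponent.

Each term thus decays when `c H([U]_s|Q)` exceeds `log p ^ s - H([X̂]_s|X)` with a margin. As the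
rate is at most about `c H(U|Q)`, the rate condition forces this (`exponent_le`). -/

/-! ### Sums of i.i.d. variables and the weak law of large numbers -/

theorem sum_fin_succ_pi {α M : Type*} [Fintype α] [AddCommMonoid M] {n : ℕ}
    (F : (Fin (n + 1) → α) → M) :
    ∑ x, F x = ∑ a, ∑ x : Fin n → α, F (Fin.cons a x) := by
  rw [← (Fin.consEquiv fun _ : Fin (n + 1) => α).sum_comp, Fintype.sum_prod_type]
  rfl

theorem sum_prod_pmf {α : Type*} [Fintype α] {P : α → ℝ} (hP : ∑ a, P a = 1) (n : ℕ) :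
    ∑ x : Fin n → α, ∏ i, P (x i) = 1 := by
  rw [← Fintype.sum_pow, hP, one_pow]

/-- The mean and the variance of a sum of `n` i.i.d. centred random variables. -/
theorem moments_iid_sum {α : Type*} [Fintype α] {P g : α → ℝ} (hP : ∑ a, P a = 1)
    (hg : ∑ a, P a * g a = 0) (n : ℕ) :
    ∑ x : Fin n → α, (∏ i, P (x i)) * ∑ i, g (x i) = 0 ∧
      ∑ x : Fin n → α, (∏ i, P (x i)) * (∑ i, g (x i)) ^ 2 = n * ∑ a, P a * g a ^ 2 := by
  induction n with
  | zero => simp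
  | succ n ih =>
    obtain ⟨h₁, h₂⟩ := ih
    have h₀ := sum_prod_pmf hP n
    constructor
    · rw [sum_fin_succ_pi]
      simp only [Fin.prod_univ_succ, Fin.sum_univ_succ, Fin.cons_zero, Fin.cons_succ]
      have : ∀ a, ∑ x : Fin n → α, P a * (∏ i, P (x i)) * (g a + ∑ i, g (x i)) =
          P a * g a := by
        intro a
        calc _ = P a * g a * ∑ x : Fin n → α, ∏ i, P (x i) +
              P a * ∑ x : Fin n → α, (∏ i, P (x i)) * ∑ i, g (x i) := by
              rw [mul_sum, mul_sum, ← sum_add_distrib]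
              exact sum_congr rfl fun x _ => by ring
          _ = _ := by rw [h₀, h₁]; ring
      simp only [this, hg]
    · rw [sum_fin_succ_pi]
      simp only [Fin.prod_univ_succ, Fin.sum_univ_succ, Fin.cons_zero, Fin.cons_succ]
      have : ∀ a, ∑ x : Fin n → α, P a * (∏ i, P (x i)) * (g a + ∑ i, g (x i)) ^ 2 =
          P a * g a ^ 2 + P a * (n * ∑ a, P a * g a ^ 2) := by
        intro a
        calc _ = P a * g a ^ 2 * ∑ x : Fin n → α, ∏ i, P (x i) +
              2 * P a * g a * ∑ x : Fin n → α, (∏ i, P (x i)) * ∑ i, g (x i) +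
              P a * ∑ x : Fin n → α, (∏ i, P (x i)) * (∑ i, g (x i)) ^ 2 := by
              rw [mul_sum, mul_sum, mul_sum, ← sum_add_distrib, ← sum_add_distrib]
              exact sum_congr rfl fun x _ => by ring
          _ = _ := by rw [h₀, h₁, h₂]; ring
      simp only [this, sum_add_distrib, ← sum_mul, hP]
      push_cast
      ring

theorem sum_comp_eq_sum_occurrences {α : Type*} [Fintype α] [DecidableEq α] {n : ℕ}
    (h : α → ℝ) (x : Fin n → α) :
    ∑ i, h (x i) = ∑ a, (occurrences a x : ℝ) * h a := by
  rw [← sum_fiberwise univ x]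
  refine sum_congr rfl fun a _ => ?_
  rw [sum_congr rfl (g := fun _ => h a) fun i hi => by rw [(mem_filter.1 hi).2], sum_const,
    nsmul_eq_mul]
  rfl

/-- Chebyshev's bound on the probability that a letter has an atypical frequency. -/
theorem sum_atypical_letter_le {α : Type*} [Fintype α] [DecidableEq α] {P : α → ℝ}
    (hP : P ∈ stdSimplex ℝ α) (a : α) {t : ℝ} (ht : 0 < t) {n : ℕ} (hn : 0 < n) :
    ∑ x : Fin n → α with t < |(occurrences a x : ℝ) / n - P a|, ∏ i, P (x i) ≤
      1 / (n * t ^ 2) := by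
  have hn' : (0 : ℝ) < n := by exact_mod_cast hn
  obtain ⟨hP0, hP1⟩ := hP
  set g : α → ℝ := fun b => (if b = a then 1 else 0) - P a with hgdef
  have hg : ∑ b, P b * g b = 0 := by
    simp [hgdef, mul_sub, sum_sub_distrib, ← sum_mul, hP1]
  have hPa : P a ≤ 1 := hP1 ▸ single_le_sum (fun b _ => hP0 b) (mem_univ a)
  have hv : ∑ b, P b * g b ^ 2 ≤ 1 := by
    calc _ ≤ ∑ b, P b := sum_le_sum fun b _ => by
            refine mul_le_of_le_one_right (hP0 b) ?_
            rw [sq_le_one_iff_abs_le_one, abs_le]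
            have := hP0 a
            simp only [hgdef]
            split_ifs <;> constructor <;> linarith
      _ = 1 := hP1
  have hs : ∀ x : Fin n → α, ∑ i, g (x i) = occurrences a x - n * P a := by
    intro x
    simp [hgdef, sum_sub_distrib, occurrences]
  have hm := (moments_iid_sum hP1 hg n).2
  rw [le_div_iff₀ (by positivity)]
  have key : (∑ x : Fin n → α with t < |(occurrences a x : ℝ) / n - P a|, ∏ i, P (x i)) *
      (n * t) ^ 2 ≤ n := by
    calc _ ≤ ∑ x : Fin n → α with t < |(occurrences a x : ℝ) / n - P a|,
            (∏ i, P (x i)) * (∑ i, g (x i)) ^ 2 := by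
          rw [sum_mul]
          refine sum_le_sum fun x hx => mul_le_mul_of_nonneg_left ?_
            (prod_nonneg fun i _ => hP0 _)
          have hx := (mem_filter.1 hx).2
          have : ∑ i, g (x i) = n * ((occurrences a x : ℝ) / n - P a) := by
            rw [hs]; field_simp
          rw [this, ← sq_abs (n * ((occurrences a x : ℝ) / n - P a)), abs_mul,
            abs_of_pos hn']
          gcongr
      _ ≤ ∑ x : Fin n → α, (∏ i, P (x i)) * (∑ i, g (x i)) ^ 2 :=
          sum_le_sum_of_subset_of_nonneg (filter_subset _ _) fun x _ _ =>
            mul_nonneg (prod_nonneg fun i _ => hP0 _) (sq_nonneg _)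
      _ ≤ n := by rw [hm]; exact mul_le_of_le_one_right hn'.le hv
  have : (n : ℝ) * ((∑ x : Fin n → α with t < |(occurrences a x : ℝ) / n - P a|,
      ∏ i, P (x i)) * (n * t ^ 2)) ≤ n * 1 := by
    calc _ = _ := by ring
      _ ≤ (n : ℝ) := key
      _ = _ := by ring
  exact le_of_mul_le_mul_left this hn'

theorem nonempty_of_mem_stdSimplex {α : Type*} [Fintype α] {P : α → ℝ}
    (hP : P ∈ stdSimplex ℝ α) : Nonempty α := by
  by_contra h
  rw [not_nonempty_iff] at h
  simpa using hP.2

open Classical in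
/-- The weak law of large numbers: long i.i.d. sequences are typical with high probability. -/
theorem exists_sum_not_isTypical_lt {α : Type*} [Fintype α] [DecidableEq α] {P : α → ℝ}
    (hP : P ∈ stdSimplex ℝ α) {ε δ : ℝ} (hε : 0 < ε) (hδ : 0 < δ) :
    ∃ N : ℕ, ∀ n : ℕ, N < n →
      ∑ x : Fin n → α with ¬ IsTypical P ε x, ∏ i, P (x i) < δ := by
  have := nonempty_of_mem_stdSimplex hP
  have hcard : (0 : ℝ) < Fintype.card α := by exact_mod_cast Fintype.card_pos
  set t : ℝ := ε / Fintype.card α with ht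
  have ht0 : 0 < t := by positivity
  obtain ⟨N, hN⟩ := exists_nat_gt (Fintype.card α / (t ^ 2 * δ))
  refine ⟨N, fun n hn => ?_⟩
  have hn0 : 0 < n := by omega
  have hn' : (0 : ℝ) < n := by exact_mod_cast hn0
  have hNn : (Fintype.card α : ℝ) / (t ^ 2 * δ) < n := hN.trans (by exact_mod_cast hn)
  rw [div_lt_iff₀ (by positivity)] at hNn
  have hnn : ∀ x : Fin n → α, 0 ≤ ∏ i, P (x i) := fun x => prod_nonneg fun i _ => hP.1 _
  calc ∑ x : Fin n → α with ¬ IsTypical P ε x, ∏ i, P (x i)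
      ≤ ∑ x : Fin n → α, ∑ a, if t < |(occurrences a x : ℝ) / n - P a| then
          ∏ i, P (x i) else 0 := by
        rw [sum_filter]
        refine sum_le_sum fun x _ => ?_
        have hnn' : ∀ a ∈ univ, 0 ≤ if t < |(occurrences a x : ℝ) / n - P a| then
          ∏ i, P (x i) else 0 := fun a _ => by split_ifs <;> simp [hnn]
        split_ifs with hx
        · exact sum_nonneg hnn'
        -- A sequence containing a letter of probability zero has probability zero, so only deviant
        -- frequencies need to be charged for.
        · by_cases hz : ∏ i, P (x i) = 0
          · rw [hz]; simp
          · rw [IsTypical, not_and_or] at hx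
            rcases hx with hx | hx
            · push Not at hx
              obtain ⟨a, ha⟩ := hx
              calc _ = if t < |(occurrences a x : ℝ) / n - P a| then
                    ∏ i, P (x i) else 0 := by rw [if_pos ha]
                _ ≤ _ := single_le_sum hnn' (mem_univ a)
            · push Not at hx
              obtain ⟨a, ha, i, hi⟩ := hx
              exact absurd (prod_eq_zero (mem_univ i) (by rw [hi, ha])) hz
    _ = ∑ a, ∑ x : Fin n → α with t < |(occurrences a x : ℝ) / n - P a|,
          ∏ i, P (x i) := by
        rw [sum_comm]; exact sum_congr rfl fun a _ => (sum_filter _ _).symm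
    _ ≤ ∑ _a : α, 1 / (n * t ^ 2) := sum_le_sum fun a _ => sum_atypical_letter_le hP a ht0 hn0
    _ = Fintype.card α / (n * t ^ 2) := by simp [div_eq_mul_inv]
    _ < δ := by
        rw [div_lt_iff₀ (by positivity)]
        linarith

/-- Along a typical sequence the average of `h` is close to its expectation. -/
theorem IsTypical.abs_sum_sub_le {α : Type*} [Fintype α] [DecidableEq α] {P : α → ℝ}
    {ε : ℝ} (hε : 0 ≤ ε) {n : ℕ} {x : Fin n → α} (hx : IsTypical P ε x) (h : α → ℝ) :
    |∑ i, h (x i) - n * ∑ a, P a * h a| ≤ n * ε * ∑ a, |h a| := by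
  rcases Nat.eq_zero_or_pos n with rfl | hn
  · simp
  have hn' : (0 : ℝ) < n := by exact_mod_cast hn
  have : ∑ i, h (x i) - n * ∑ a, P a * h a =
      ∑ a, n * (((occurrences a x : ℝ) / n - P a) * h a) := by
    rw [sum_comp_eq_sum_occurrences, mul_sum, ← sum_sub_distrib]
    refine sum_congr rfl fun a _ => ?_
    field_simp
  rw [this]
  refine (abs_sum_le_sum_abs _ _).trans ?_
  rw [mul_sum]
  refine sum_le_sum fun a _ => ?_
  rw [abs_mul, abs_mul, abs_of_pos hn', mul_assoc]
  refine mul_le_mul_of_nonneg_left (mul_le_mul_of_nonneg_right ((hx.1 a).trans ?_)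
    (abs_nonneg _)) hn'.le
  have : Nonempty α := ⟨a⟩
  exact div_le_self hε (by exact_mod_cast Fintype.card_pos)

/-! ### Conditional probabilities on fibres and the counting of typical sequences -/

theorem law_nonneg {Ω α : Type*} [Fintype Ω] [DecidableEq α] {P : Ω → ℝ} (hP : ∀ ω, 0 ≤ P ω)
    (f : Ω → α) (a : α) : 0 ≤ law P f a :=
  sum_nonneg fun ω _ => hP ω

theorem le_law {Ω α : Type*} [Fintype Ω] [DecidableEq α] {P : Ω → ℝ} (hP : ∀ ω, 0 ≤ P ω)
    (f : Ω → α) (ω : Ω) : P ω ≤ law P f (f ω) :=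
  single_le_sum (f := P) (fun ω _ => hP ω) (by simp)

theorem law_pos {Ω α : Type*} [Fintype Ω] [DecidableEq α] {P : Ω → ℝ} (hP : ∀ ω, 0 ≤ P ω)
    (f : Ω → α) {ω : Ω} (hω : P ω ≠ 0) : 0 < law P f (f ω) :=
  ((hP ω).lt_of_ne' hω).trans_le (le_law hP f ω)

/-- The probability of the outcome `ω` given the value `f ω`. -/
noncomputable def fiberProb {Ω α : Type*} [Fintype Ω] [DecidableEq α] (P : Ω → ℝ) (f : Ω → α)
    (ω : Ω) : ℝ :=
  P ω / law P f (f ω)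

/-- The expectation of the logarithm of `fiberProb`, that is `-H(ω | f ω)`. -/
noncomputable def meanLogFiber {Ω α : Type*} [Fintype Ω] [DecidableEq α] (P : Ω → ℝ)
    (f : Ω → α) : ℝ :=
  ∑ ω, P ω * Real.logb 2 (fiberProb P f ω)

/-- The sum of the absolute values of the logarithms of `fiberProb`. -/
noncomputable def absLogFiber {Ω α : Type*} [Fintype Ω] [DecidableEq α] (P : Ω → ℝ)
    (f : Ω → α) : ℝ :=
  ∑ ω, |Real.logb 2 (fiberProb P f ω)|

section Counting

variable {Ω α : Type*} [Fintype Ω] [DecidableEq Ω] [DecidableEq α] {P : Ω → ℝ}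

/-- Typical sequences avoid null letters, so every factor is positive and its logarithm is not the
default value of `logb` at zero. -/
theorem IsTypical.prod_fiberProb_eq (hP : ∀ ω, 0 ≤ P ω) (f : Ω → α) {ε : ℝ} {n : ℕ}
    {x : Fin n → Ω} (hx : IsTypical P ε x) :
    ∏ i, fiberProb P f (x i) = (2 : ℝ) ^ ∑ i, Real.logb 2 (fiberProb P f (x i)) := by
  rw [Real.rpow_sum_of_pos two_pos]
  refine prod_congr rfl fun i _ => ?_
  have h0 : P (x i) ≠ 0 := fun h => hx.2 _ h i rfl
  rw [Real.rpow_logb two_pos (by norm_num)]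
  exact div_pos ((hP _).lt_of_ne' h0) (law_pos hP f h0)

theorem IsTypical.prod_fiberProb_ge (hP : ∀ ω, 0 ≤ P ω) (f : Ω → α) {ε : ℝ} (hε : 0 ≤ ε)
    {n : ℕ} {x : Fin n → Ω} (hx : IsTypical P ε x) :
    (2 : ℝ) ^ (n * (meanLogFiber P f - ε * absLogFiber P f)) ≤ ∏ i, fiberProb P f (x i) := by
  rw [hx.prod_fiberProb_eq hP f]
  refine Real.rpow_le_rpow_of_exponent_le (by norm_num) ?_
  have := (abs_le.1 (hx.abs_sum_sub_le hε fun ω => Real.logb 2 (fiberProb P f ω))).1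
  simp only [meanLogFiber, absLogFiber]
  linarith

theorem IsTypical.prod_fiberProb_le (hP : ∀ ω, 0 ≤ P ω) (f : Ω → α) {ε : ℝ} (hε : 0 ≤ ε)
    {n : ℕ} {x : Fin n → Ω} (hx : IsTypical P ε x) :
    ∏ i, fiberProb P f (x i) ≤ (2 : ℝ) ^ (n * (meanLogFiber P f + ε * absLogFiber P f)) := by
  rw [hx.prod_fiberProb_eq hP f]
  refine Real.rpow_le_rpow_of_exponent_le (by norm_num) ?_
  have := (abs_le.1 (hx.abs_sum_sub_le hε fun ω => Real.logb 2 (fiberProb P f ω))).2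
  simp only [meanLogFiber, absLogFiber]
  linarith

/-- The sum factorises over the coordinates. Each factor is the total conditional probability of a
fibre, which is 1, or 0 by the convention for division by zero when the fibre is null. -/
theorem sum_prod_fiberProb_le_one {Ω : Type*} [Fintype Ω] {P : Ω → ℝ} (hP : ∀ ω, 0 ≤ P ω) (f : Ω → α) {n : ℕ} (z : Fin n → α) :
    ∑ x : Fin n → Ω with ∀ i, f (x i) = z i, ∏ i, fiberProb P f (x i) ≤ 1 := by
  have : (univ.filter fun x : Fin n → Ω => ∀ i, f (x i) = z i) =
      Fintype.piFinset fun i => univ.filter fun ω => f ω = z i := by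
    ext x; simp
  rw [this, ← prod_univ_sum (fun i => univ.filter fun ω => f ω = z i) fun _ ω => fiberProb P f ω]
  refine prod_le_one (fun i _ => sum_nonneg fun ω _ => div_nonneg (hP _) (law_nonneg hP _ _))
    fun i _ => ?_
  rw [sum_congr rfl (g := fun ω => P ω / law P f (z i)) fun ω hω => by
    rw [fiberProb, (mem_filter.1 hω).2], ← sum_div]
  exact div_self_le_one _

/-- At most `2 ^ (n (H(ω | f ω) + O(ε)))` typical sequences have a given image under `f`. -/
theorem card_typical_fiber_le (hP : ∀ ω, 0 ≤ P ω) (f : Ω → α) {ε : ℝ} (hε : 0 ≤ ε) {n : ℕ}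
    (z : Fin n → α) (S : Finset (Fin n → Ω)) (hS : ∀ x ∈ S, IsTypical P ε x)
    (hz : ∀ x ∈ S, ∀ i, f (x i) = z i) :
    (S.card : ℝ) ≤ (2 : ℝ) ^ (n * (-meanLogFiber P f + ε * absLogFiber P f)) := by
  have h1 : (S.card : ℝ) * (2 : ℝ) ^ (n * (meanLogFiber P f - ε * absLogFiber P f)) ≤ 1 := by
    calc _ = ∑ _x ∈ S, (2 : ℝ) ^ (n * (meanLogFiber P f - ε * absLogFiber P f)) := by
          rw [sum_const, nsmul_eq_mul]
      _ ≤ ∑ x ∈ S, ∏ i, fiberProb P f (x i) :=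
          sum_le_sum fun x hx => (hS x hx).prod_fiberProb_ge hP f hε
      _ ≤ ∑ x : Fin n → Ω with ∀ i, f (x i) = z i, ∏ i, fiberProb P f (x i) := by
          refine sum_le_sum_of_subset_of_nonneg (fun x hx => by simpa using hz x hx)
            fun x _ _ => prod_nonneg fun i _ => div_nonneg (hP _) (law_nonneg hP _ _)
      _ ≤ 1 := sum_prod_fiberProb_le_one hP f z
  rw [← le_div_iff₀ (by positivity), one_div, ← Real.rpow_neg two_pos.le] at h1
  refine h1.trans_eq ?_
  congr 1
  ring

theorem sum_prod_fiberProb_le_card_mul (hP : ∀ ω, 0 ≤ P ω) (f : Ω → α) {ε : ℝ} (hε : 0 ≤ ε)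
    {n : ℕ} (S : Finset (Fin n → Ω)) (hS : ∀ x ∈ S, IsTypical P ε x) :
    ∑ x ∈ S, ∏ i, fiberProb P f (x i) ≤
      S.card * (2 : ℝ) ^ (n * (meanLogFiber P f + ε * absLogFiber P f)) := by
  rw [← nsmul_eq_mul, ← sum_const]
  exact sum_le_sum fun x hx => (hS x hx).prod_fiberProb_le hP f hε

end Counting

/-! ### Divisibility by powers of `p` and linear equations over `ℤ_{p ^ r}` -/

theorem cosetRep_eq_of_dvd_sub {p r s : ℕ} [NeZero (p ^ r)] (hs : s ≤ r) {a b : ZMod (p ^ r)}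
    (h : (p : ZMod (p ^ r)) ^ s ∣ a - b) : cosetRep p r s a = cosetRep p r s b := by
  obtain ⟨c, hc⟩ := h
  have h1 : ((a.val : ℕ) : ZMod (p ^ r)) = ((b.val + p ^ s * c.val : ℕ) : ZMod (p ^ r)) := by
    push_cast
    rw [ZMod.natCast_zmod_val, ZMod.natCast_zmod_val, ZMod.natCast_zmod_val, ← hc]
    ring
  have h2 : a.val ≡ b.val + p ^ s * c.val [MOD p ^ s] :=
    ((ZMod.natCast_eq_natCast_iff _ _ _).1 h1).of_dvd (pow_dvd_pow p hs)
  have h3 : a.val % p ^ s = b.val % p ^ s := by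
    rw [h2, Nat.add_mul_mod_self_left]
  simp [cosetRep, h3]

theorem isUnit_or_prime_dvd {p r : ℕ} [Fact p.Prime] (c : ZMod (p ^ r)) :
    IsUnit c ∨ (p : ZMod (p ^ r)) ∣ c := by
  rw [← ZMod.natCast_zmod_val c, ZMod.isUnit_iff_coprime]
  by_cases h : p ∣ c.val
  · exact Or.inr (Nat.cast_dvd_cast h)
  · exact Or.inl (((Nat.Prime.coprime_iff_not_dvd Fact.out).2 h).symm.pow_right r)

/-- A vector over `ℤ_{p ^ r}` is `p ^ s` times a vector with an invertible coordinate, or zero. -/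
theorem exists_level {p r : ℕ} [Fact p.Prime] {ι : Type*} (d : ι → ZMod (p ^ r)) :
    ∃ s ≤ r, (∀ j, (p : ZMod (p ^ r)) ^ s ∣ d j) ∧
      (s = r ∨ ∃ j c, IsUnit c ∧ d j = (p : ZMod (p ^ r)) ^ s * c) := by
  classical
  -- When the greatest such `s` is below `r`, some coordinate has a cofactor not divisible by `p`,
  -- and in this local ring such a cofactor is a unit.
  set s := Nat.findGreatest (fun s => ∀ j, (p : ZMod (p ^ r)) ^ s ∣ d j) r with hsdef
  have hs : ∀ j, (p : ZMod (p ^ r)) ^ s ∣ d j :=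
    Nat.findGreatest_spec (P := fun s => ∀ j, (p : ZMod (p ^ r)) ^ s ∣ d j) (Nat.zero_le r)
      (by simp)
  have hsr : s ≤ r := Nat.findGreatest_le r
  refine ⟨s, hsr, hs, ?_⟩
  rcases hsr.eq_or_lt with h | h
  · exact Or.inl h
  · right
    have := Nat.findGreatest_is_greatest (P := fun s => ∀ j, (p : ZMod (p ^ r)) ^ s ∣ d j)
      (Nat.lt_succ_self s) h
    push Not at this
    obtain ⟨j, hj⟩ := this
    obtain ⟨c, hc⟩ := hs j
    refine ⟨j, c, (isUnit_or_prime_dvd c).resolve_right fun ⟨e, he⟩ => hj ⟨e, ?_⟩, hc⟩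
    rw [hc, he, pow_succ, mul_assoc]

/-- If `d` is `p ^ s` times a vector with an invertible coordinate, the solutions `G` of
`d G = z` make up at most a fraction `p ^ (-(r - s) n)` of all matrices. -/
theorem card_vecMul_eq_mul_le {p r s n : ℕ} [Fact p.Prime] {ι : Type*} [Fintype ι]
    [DecidableEq ι] (hs : s ≤ r) (d : ι → ZMod (p ^ r))
    (hd : s = r ∨ ∃ j c, IsUnit c ∧ d j = (p : ZMod (p ^ r)) ^ s * c)
    (z : Fin n → ZMod (p ^ r)) :
    (univ.filter fun G : Matrix ι (Fin n) (ZMod (p ^ r)) => Matrix.vecMul d G = z).card *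
      p ^ ((r - s) * n) ≤ Fintype.card (Matrix ι (Fin n) (ZMod (p ^ r))) := by
  rcases hd with rfl | ⟨j, c, hc, hj⟩
  · simpa using card_le_univ _
  have hp : p.Prime := Fact.out
  set S := univ.filter fun G : Matrix ι (Fin n) (ZMod (p ^ r)) => Matrix.vecMul d G = z with hS
  have hcard : p ^ ((r - s) * n) = (univ : Finset (Fin n → Fin (p ^ (r - s)))).card := by
    simp [pow_mul]
  rw [hcard, ← card_product, ← card_univ]
  -- Adding `t` to row `j` shifts `d G` by `p ^ s * c * t`, and these shifts are distinct for
  -- entries `t < p ^ (r - s)`. Hence the translates of the solution set by the matrices `E t` are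
  -- disjoint.
  let E : (Fin n → Fin (p ^ (r - s))) → Matrix ι (Fin n) (ZMod (p ^ r)) := fun t =>
    Matrix.of fun i l => if i = j then ((t l : ℕ) : ZMod (p ^ r)) else 0
  have hE : ∀ t l, Matrix.vecMul d (E t) l = d j * ((t l : ℕ) : ZMod (p ^ r)) := by
    intro t l
    simp [Matrix.vecMul, dotProduct, E]
  refine card_le_card_of_injOn (fun x => x.1 + E x.2) (fun _ _ => by simp) ?_
  rintro ⟨G, t⟩ hG ⟨G', t'⟩ hG' h
  simp only [coe_product, Set.mem_prod, hS, coe_filter, mem_univ, true_and,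
    Set.mem_ofPred_eq, coe_univ, Set.mem_univ, and_true] at hG hG' h
  have ht : t = t' := by
    funext l
    have h1 : Matrix.vecMul d (G + E t) l = Matrix.vecMul d (G' + E t') l := by rw [h]
    rw [Matrix.vecMul_add, Matrix.vecMul_add, hG, hG', Pi.add_apply, Pi.add_apply, hE, hE,
      hj, mul_right_comm, mul_right_comm _ c] at h1
    have h2 : ((p ^ s * t l : ℕ) : ZMod (p ^ r)) = ((p ^ s * t' l : ℕ) : ZMod (p ^ r)) := by
      push_cast
      exact hc.mul_right_cancel (add_left_cancel h1)
    have hlt : ∀ x : Fin (p ^ (r - s)), p ^ s * (x : ℕ) < p ^ r := by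
      intro x
      calc p ^ s * (x : ℕ) < p ^ s * p ^ (r - s) :=
            Nat.mul_lt_mul_of_pos_left x.2 (pow_pos hp.pos s)
        _ = p ^ r := by rw [← pow_add, Nat.add_sub_cancel' hs]
    have h3 := Nat.ModEq.eq_of_lt_of_lt ((ZMod.natCast_eq_natCast_iff _ _ _).1 h2)
      (hlt _) (hlt _)
    exact Fin.ext (Nat.eq_of_mul_eq_mul_left (pow_pos hp.pos s) h3)
  subst ht
  simpa using h

/-! ### Second moment of the number of codewords in a given set -/

/-- The pairs of vectors in `S` that agree modulo `p ^ s`. -/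
noncomputable def congrPairs {p r : ℕ} {κ : Type*} [Fintype κ]
    (S : Finset (κ → ZMod (p ^ r))) (s : ℕ) :
    Finset ((κ → ZMod (p ^ r)) × (κ → ZMod (p ^ r))) :=
  (S ×ˢ S).filter fun y => ∀ i, cosetRep p r s (y.2 i) = cosetRep p r s (y.1 i)

theorem card_congrPairs_le {p r : ℕ} {κ : Type*} [Fintype κ]
    (S : Finset (κ → ZMod (p ^ r))) (s : ℕ) {A : ℝ}
    (hA : ∀ y ∈ S, ((S.filter fun y' => ∀ i, cosetRep p r s (y' i) =
      cosetRep p r s (y i)).card : ℝ) ≤ A) :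
    ((congrPairs S s).card : ℝ) ≤ S.card * A := by
  rw [congrPairs, card_filter, sum_product]
  push_cast
  rw [← nsmul_eq_mul, ← sum_const]
  refine sum_le_sum fun y hy => ?_
  refine le_trans (le_of_eq ?_) (hA y hy)
  rw [card_filter]
  push_cast
  rfl

theorem card_congrPairs_le_sq {p r : ℕ} {κ : Type*} [Fintype κ]
    (S : Finset (κ → ZMod (p ^ r))) (s : ℕ) :
    ((congrPairs S s).card : ℝ) ≤ (S.card : ℝ) ^ 2 := by
  have := card_filter_le (S ×ˢ S) fun y => ∀ i, cosetRep p r s (y.2 i) = cosetRep p r s (y.1 i)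
  rw [card_product, ← sq] at this
  exact_mod_cast this

section SecondMoment

variable {p r n : ℕ} [Fact p.Prime] {ι : Type*} [Fintype ι] [DecidableEq ι]

/-- The number of `(G, b)` for which `u G + b` and `u' G + b` both lie in `T`. -/
theorem exists_card_pair_mul_le (T : Finset (Fin n → ZMod (p ^ r)))
    (u u' : ι → ZMod (p ^ r)) :
    ∃ s ≤ r, (∀ j, cosetRep p r s (u' j) = cosetRep p r s (u j)) ∧
      (univ.filter fun ω : Matrix ι (Fin n) (ZMod (p ^ r)) × (Fin n → ZMod (p ^ r)) =>
        Matrix.vecMul u ω.1 + ω.2 ∈ T ∧ Matrix.vecMul u' ω.1 + ω.2 ∈ T).card *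
          p ^ ((r - s) * n) ≤
        Fintype.card (Matrix ι (Fin n) (ZMod (p ^ r))) * (congrPairs T s).card := by
  obtain ⟨s, hs, hdvd, hunit⟩ := exists_level (u' - u)
  refine ⟨s, hs, fun j => cosetRep_eq_of_dvd_sub hs (hdvd j), ?_⟩
  have hq : 0 < p ^ ((r - s) * n) := pow_pos (Nat.Prime.pos Fact.out) _
  set M := Fintype.card (Matrix ι (Fin n) (ZMod (p ^ r)))
  -- Count by the pair of codewords `(y, y')`, which lies in `congrPairs T s`. Over a given pair,
  -- `b` is determined by `G`, and `G` solves `(u' - u) G = y' - y`.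
  have key := card_le_mul_card_image_of_maps_to
    (s := univ.filter fun ω : Matrix ι (Fin n) (ZMod (p ^ r)) × (Fin n → ZMod (p ^ r)) =>
        Matrix.vecMul u ω.1 + ω.2 ∈ T ∧ Matrix.vecMul u' ω.1 + ω.2 ∈ T)
    (t := congrPairs T s)
    (f := fun ω => (Matrix.vecMul u ω.1 + ω.2, Matrix.vecMul u' ω.1 + ω.2)) ?_
    (M / p ^ ((r - s) * n)) ?_
  · calc _ ≤ M / p ^ ((r - s) * n) * (congrPairs T s).card * p ^ ((r - s) * n) :=
          Nat.mul_le_mul_right _ key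
      _ = M / p ^ ((r - s) * n) * p ^ ((r - s) * n) * (congrPairs T s).card := by ring
      _ ≤ _ := Nat.mul_le_mul_right _ (Nat.div_mul_le_self _ _)
  · rintro ⟨G, b⟩ h
    simp only [mem_filter, mem_univ, true_and] at h
    simp only [congrPairs, mem_filter, mem_product]
    refine ⟨h, fun i => cosetRep_eq_of_dvd_sub hs ?_⟩
    have : (Matrix.vecMul u' G + b) i - (Matrix.vecMul u G + b) i =
        Matrix.vecMul (u' - u) G i := by
      rw [Matrix.sub_vecMul]; simp
    rw [this]
    exact dvd_sum fun j _ => (hdvd j).mul_right _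
  · rintro ⟨y, y'⟩ -
    rw [Nat.le_div_iff_mul_le hq]
    refine le_trans (Nat.mul_le_mul_right _ ?_)
      (card_vecMul_eq_mul_le hs (u' - u) hunit (y' - y))
    refine card_le_card_of_injOn Prod.fst ?_ ?_
    · rintro ⟨G, b⟩ h
      simp only [coe_filter, mem_filter, mem_univ, true_and, Set.mem_ofPred_eq,
        Prod.mk.injEq] at h ⊢
      rw [Matrix.sub_vecMul, ← h.2.1, ← h.2.2]
      abel
    · rintro ⟨G, b⟩ h ⟨G', b'⟩ h' hG
      simp only [coe_filter, mem_filter, mem_univ, true_and, Set.mem_ofPred_eq,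
        Prod.mk.injEq] at h h' hG ⊢
      subst hG
      exact ⟨rfl, add_left_cancel (h.2.1.trans h'.2.1.symm)⟩

/-- Chebyshev's inequality for the number of points at which a counting function vanishes. -/
theorem card_zeros_mul_sq_le {Ω : Type*} [Fintype Ω] [DecidableEq Ω] (f : Ω → ℝ) {μ E : ℝ}
    (h1 : ∑ ω, f ω = Fintype.card Ω * μ)
    (h2 : ∑ ω, f ω ^ 2 ≤ Fintype.card Ω * μ ^ 2 + E) (Z : Finset Ω) (hZ : ∀ ω ∈ Z, f ω = 0) :
    Z.card * μ ^ 2 ≤ E := by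
  calc (Z.card : ℝ) * μ ^ 2 = ∑ ω ∈ Z, (f ω - μ) ^ 2 := by
        rw [← nsmul_eq_mul, ← sum_const]
        exact sum_congr rfl fun ω hω => by rw [hZ ω hω]; ring
    _ ≤ ∑ ω, (f ω - μ) ^ 2 :=
        sum_le_sum_of_subset_of_nonneg (subset_univ _) fun _ _ _ => sq_nonneg _
    _ = ∑ ω, f ω ^ 2 - 2 * μ * ∑ ω, f ω + Fintype.card Ω * μ ^ 2 := by
        rw [mul_sum, ← sum_sub_distrib, ← nsmul_eq_mul, ← card_univ, ← sum_const,
          ← sum_add_distrib]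
        exact sum_congr rfl fun ω _ => by ring
    _ ≤ E := by rw [h1]; linarith

/-- The second moment bound for the probability that the random coset code with index set `U`
misses the set `T`. -/
theorem card_miss_div_le (U : Finset (ι → ZMod (p ^ r))) (T : Finset (Fin n → ZMod (p ^ r)))
    (hU : U.Nonempty) (hT : T.Nonempty) (A B : ℕ → ℝ)
    (hA : ∀ s, 1 ≤ s → s ≤ r → ∀ u ∈ U, ((U.filter fun u' => ∀ i, cosetRep p r s (u' i) =
      cosetRep p r s (u i)).card : ℝ) ≤ A s)
    (hB : ∀ s, 1 ≤ s → s ≤ r → ∀ y ∈ T, ((T.filter fun y' => ∀ i, cosetRep p r s (y' i) =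
      cosetRep p r s (y i)).card : ℝ) ≤ B s) :
    ((univ.filter fun ω : Matrix ι (Fin n) (ZMod (p ^ r)) × (Fin n → ZMod (p ^ r)) =>
        ∀ u ∈ U, Matrix.vecMul u ω.1 + ω.2 ∉ T).card : ℝ) /
      (Fintype.card (Matrix ι (Fin n) (ZMod (p ^ r))) *
        Fintype.card (Fin n → ZMod (p ^ r))) ≤
      ∑ s ∈ Icc 1 r, A s / U.card * (B s / T.card) * (p : ℝ) ^ (s * n) := by
  have hp : (0 : ℝ) < p := by exact_mod_cast Nat.Prime.pos (Fact.out : p.Prime)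
  have hUc : (0 : ℝ) < U.card := by exact_mod_cast hU.card_pos
  have hTc : (0 : ℝ) < T.card := by exact_mod_cast hT.card_pos
  set M : ℝ := (Fintype.card (Matrix ι (Fin n) (ZMod (p ^ r))) : ℝ) with hM
  have hM0 : 0 < M := by
    rw [hM]
    exact_mod_cast Fintype.card_pos (α := Matrix ι (Fin n) (ZMod (p ^ r)))
  have hV : (Fintype.card (Fin n → ZMod (p ^ r)) : ℝ) = (p : ℝ) ^ (r * n) := by
    simp [ZMod.card, pow_mul]
  rw [hV]
  set f : Matrix ι (Fin n) (ZMod (p ^ r)) × (Fin n → ZMod (p ^ r)) → ℝ := fun ω =>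
    ∑ u ∈ U, if Matrix.vecMul u ω.1 + ω.2 ∈ T then 1 else 0 with hf
  set μ : ℝ := U.card * T.card / (p : ℝ) ^ (r * n) with hμ
  set E : ℝ := ∑ s ∈ Icc 1 r,
    (U.card * A s) * (T.card * B s) * M / (p : ℝ) ^ ((r - s) * n) with hE
  have hcard : (Fintype.card (Matrix ι (Fin n) (ZMod (p ^ r)) × (Fin n → ZMod (p ^ r))) : ℝ) =
      M * (p : ℝ) ^ (r * n) := by
    rw [Fintype.card_prod, Nat.cast_mul, hV]
  have hmean : ∑ ω, f ω = Fintype.card (Matrix ι (Fin n) (ZMod (p ^ r)) ×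
      (Fin n → ZMod (p ^ r))) * μ := by
    rw [hcard, hμ]
    have : ∀ (u : ι → ZMod (p ^ r)) (G : Matrix ι (Fin n) (ZMod (p ^ r))),
        ∑ b : Fin n → ZMod (p ^ r), (if Matrix.vecMul u G + b ∈ T then (1 : ℝ) else 0) =
          T.card := by
      intro u G
      exact (Equiv.sum_comp (Equiv.addLeft (Matrix.vecMul u G))
        (fun y => if y ∈ T then (1 : ℝ) else 0)).trans (by simp)
    rw [hf, sum_comm]
    simp only [Fintype.sum_prod_type, this, sum_const, card_univ, nsmul_eq_mul]
    rw [← hM]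
    field_simp
  have hsq : ∑ ω, f ω ^ 2 ≤ Fintype.card (Matrix ι (Fin n) (ZMod (p ^ r)) ×
      (Fin n → ZMod (p ^ r))) * μ ^ 2 + E := by
    -- Only the exact level of the pair is needed. Summing over every `s` at which `u` and `u'`
    -- agree adds nonnegative terms and removes the dependence of `s` on the pair.
    have hpair : ∀ u u' : ι → ZMod (p ^ r), ∑ ω : Matrix ι (Fin n) (ZMod (p ^ r)) ×
        (Fin n → ZMod (p ^ r)), ((if Matrix.vecMul u ω.1 + ω.2 ∈ T then (1 : ℝ) else 0) *
          if Matrix.vecMul u' ω.1 + ω.2 ∈ T then 1 else 0) ≤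
        ∑ s ∈ range (r + 1), if (∀ i, cosetRep p r s (u' i) = cosetRep p r s (u i)) then
          (congrPairs T s).card * M / (p : ℝ) ^ ((r - s) * n) else 0 := by
      intro u u'
      obtain ⟨s, hs, hc, hle⟩ := exists_card_pair_mul_le T u u'
      have hnn : ∀ s ∈ range (r + 1), 0 ≤ if (∀ i, cosetRep p r s (u' i) =
          cosetRep p r s (u i)) then
          (congrPairs T s).card * M / (p : ℝ) ^ ((r - s) * n) else 0 := fun s _ => by
        split_ifs <;> positivity
      refine le_trans ?_ (single_le_sum hnn (mem_range.2 (Nat.lt_succ_of_le hs)))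
      rw [if_pos hc, le_div_iff₀ (by positivity)]
      have : ∑ ω : Matrix ι (Fin n) (ZMod (p ^ r)) × (Fin n → ZMod (p ^ r)),
          ((if Matrix.vecMul u ω.1 + ω.2 ∈ T then (1 : ℝ) else 0) *
            if Matrix.vecMul u' ω.1 + ω.2 ∈ T then 1 else 0) =
          (univ.filter fun ω : Matrix ι (Fin n) (ZMod (p ^ r)) × (Fin n → ZMod (p ^ r)) =>
            Matrix.vecMul u ω.1 + ω.2 ∈ T ∧ Matrix.vecMul u' ω.1 + ω.2 ∈ T).card := by
        rw [card_filter]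
        push_cast
        refine sum_congr rfl fun ω _ => ?_
        rw [ite_and]
        split_ifs <;> simp
      rw [this, mul_comm (((congrPairs T s).card : ℕ) : ℝ)]
      rw [hM]
      exact_mod_cast hle
    calc ∑ ω, f ω ^ 2 = ∑ u ∈ U, ∑ u' ∈ U, ∑ ω : Matrix ι (Fin n) (ZMod (p ^ r)) ×
          (Fin n → ZMod (p ^ r)), ((if Matrix.vecMul u ω.1 + ω.2 ∈ T then (1 : ℝ) else 0) *
          if Matrix.vecMul u' ω.1 + ω.2 ∈ T then 1 else 0) := by
          simp only [hf, sq, sum_mul_sum]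
          rw [sum_comm]
          exact sum_congr rfl fun u _ => sum_comm
      _ ≤ ∑ u ∈ U, ∑ u' ∈ U, ∑ s ∈ range (r + 1),
          if (∀ i, cosetRep p r s (u' i) = cosetRep p r s (u i)) then
          (congrPairs T s).card * M / (p : ℝ) ^ ((r - s) * n) else 0 :=
          sum_le_sum fun u _ => sum_le_sum fun u' _ => hpair u u'
      _ = ∑ s ∈ range (r + 1), ((congrPairs U s).card : ℝ) *
          ((congrPairs T s).card * M / (p : ℝ) ^ ((r - s) * n)) := by
          rw [← sum_product', sum_comm]
          refine sum_congr rfl fun s _ => ?_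
          rw [← sum_filter, sum_const, nsmul_eq_mul]
          rfl
      _ = ((congrPairs U 0).card : ℝ) * ((congrPairs T 0).card * M / (p : ℝ) ^ (r * n)) +
          ∑ s ∈ Icc 1 r, ((congrPairs U s).card : ℝ) *
          ((congrPairs T s).card * M / (p : ℝ) ^ ((r - s) * n)) := by
          rw [range_eq_Ico, sum_eq_sum_Ico_succ_bot (Nat.succ_pos r)]
          rfl
      _ ≤ _ := by
          refine add_le_add ?_ ?_
          -- Level `s = 0` imposes no congruence. It yields exactly the squared mean, which cancels
          -- in the variance.
          · calc _ ≤ (U.card : ℝ) ^ 2 * ((T.card : ℝ) ^ 2 * M / (p : ℝ) ^ (r * n)) := by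
                  gcongr
                  · exact card_congrPairs_le_sq U 0
                  · exact card_congrPairs_le_sq T 0
              _ = _ := by rw [hcard, hμ]; field_simp
          · refine sum_le_sum fun s hs => ?_
            obtain ⟨hs1, hsr⟩ := mem_Icc.1 hs
            have h1 := card_congrPairs_le U s (hA s hs1 hsr)
            have h2 := card_congrPairs_le T s (A := B s) fun y hy => by
              convert hB s hs1 hsr y hy
            have h3 : ((congrPairs U s).card : ℝ) * (congrPairs T s).card ≤
                (U.card * A s) * (T.card * B s) :=
              mul_le_mul h1 h2 (Nat.cast_nonneg _) ((Nat.cast_nonneg _).trans h1)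
            calc _ = ((congrPairs U s).card : ℝ) * (congrPairs T s).card * M /
                  (p : ℝ) ^ ((r - s) * n) := by ring
              _ ≤ _ := by gcongr
  have key := card_zeros_mul_sq_le f hmean hsq
    (univ.filter fun ω => ∀ u ∈ U, Matrix.vecMul u ω.1 + ω.2 ∉ T)
    (fun ω hω => sum_eq_zero fun u hu => if_neg ((mem_filter.1 hω).2 u hu))
  have hμ0 : 0 < μ := by positivity
  have hR : ∑ s ∈ Icc 1 r, A s / U.card * (B s / T.card) * (p : ℝ) ^ (s * n) =
      E / μ ^ 2 / (M * (p : ℝ) ^ (r * n)) := by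
    rw [hE, sum_div, sum_div]
    refine sum_congr rfl fun s hs => ?_
    obtain ⟨hs1, hsr⟩ := mem_Icc.1 hs
    have : (p : ℝ) ^ (r * n) = (p : ℝ) ^ (s * n) * (p : ℝ) ^ ((r - s) * n) := by
      rw [← pow_add, ← add_mul, Nat.add_sub_cancel' hsr]
    rw [hμ, this]
    field_simp
  rw [hR]
  gcongr
  rw [le_div_iff₀ (by positivity)]
  exact key

end SecondMoment

/-! ### Chain rule and entropy conditioned on `Q` -/

section Entropy

variable {Ω α β : Type*} [Fintype Ω] [Fintype α] [DecidableEq α] [Fintype β] [DecidableEq β]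

/-- As an expectation over outcomes, the entropy can be compared with `meanLogFiber` one `ω` at a
time. -/
theorem condEntropy_eq_sum (P : Ω → ℝ) (V : Ω → α) (W : Ω → β) :
    condEntropy P V W = -∑ ω, P ω *
      Real.logb 2 (law P (fun ω => (V ω, W ω)) (V ω, W ω) / law P W (W ω)) := by
  rw [condEntropy, ← sum_fiberwise univ fun ω => (V ω, W ω), Fintype.sum_prod_type]
  congr 1
  refine sum_congr rfl fun a _ => sum_congr rfl fun b _ => ?_
  conv_lhs => enter [1]; rw [law]
  rw [sum_mul]
  refine sum_congr rfl fun ω hω => ?_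
  obtain ⟨rfl, rfl⟩ := Prod.mk.injEq _ _ _ _ ▸ (mem_filter.1 hω).2
  rfl

/-- The chain rule `H(ω | W) = H(ω | V, W) + H(V | W)`. -/
theorem meanLogFiber_eq_add {P : Ω → ℝ} (hP : ∀ ω, 0 ≤ P ω) (V : Ω → α) (W : Ω → β) :
    meanLogFiber P W = meanLogFiber P (fun ω => (V ω, W ω)) - condEntropy P V W := by
  rw [condEntropy_eq_sum, sub_neg_eq_add, meanLogFiber, meanLogFiber, ← sum_add_distrib]
  refine sum_congr rfl fun ω _ => ?_
  by_cases h : P ω = 0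
  · simp [h]
  · have h1 := (law_pos hP W h).ne'
    have h2 := (law_pos hP (fun ω => (V ω, W ω)) h).ne'
    rw [← mul_add, fiberProb, fiberProb, ← Real.logb_mul (by positivity) (by positivity)]
    congr 2
    field_simp

/-- Given `ω` itself nothing is uncertain: `fiberProb` is 1, or `0 / 0 = 0` at null outcomes, and
`logb` vanishes at both. -/
theorem meanLogFiber_unit [DecidableEq Ω] {P : Ω → ℝ} (hP : ∀ ω, 0 ≤ P ω) :
    meanLogFiber P (fun _ => ()) = -condEntropy P (fun ω => ω) (fun _ => ()) := by
  rw [meanLogFiber_eq_add hP (fun ω => ω)]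
  have : meanLogFiber P (fun ω : Ω => (ω, ())) = 0 := by
    refine sum_eq_zero fun ω _ => ?_
    have : law P (fun ω : Ω => (ω, ())) (ω, ()) = P ω := by simp [law, filter_eq']
    rw [fiberProb, this]
    by_cases h : P ω = 0 <;> simp [h]
  rw [this, zero_sub]

theorem law_snd {α Q : Type*} [Fintype α] [DecidableEq Q] [Fintype Q] (P : α × Q → ℝ) (q : Q) :
    law P Prod.snd q = ∑ a, P (a, q) := by
  rw [law, sum_filter, Fintype.sum_prod_type]
  simp

theorem law_fst {Q : Type*} [Fintype Q] (P : α × Q → ℝ) (a : α) :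
    law P Prod.fst a = ∑ q, P (a, q) := by
  rw [law, sum_filter, Fintype.sum_prod_type_right]
  simp

theorem condLaw_mem_stdSimplex {α Q : Type*} [Fintype α] [Fintype Q] [DecidableEq Q] {P : α × Q → ℝ}
    (hP : ∀ ω, 0 ≤ P ω) {q : Q} (hq : 0 < law P Prod.snd q) :
    condLaw P q ∈ stdSimplex ℝ α := by
  refine ⟨fun a => div_nonneg (hP _) hq.le, ?_⟩
  simp only [condLaw]
  rw [← sum_div, ← law_snd, div_self hq.ne']

/-- `H(V(U) | Q)` is the average of the entropies of `V(U)` given `Q = q`. -/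
theorem condEntropy_eq_sum_condLaw {α Q : Type*} [Fintype α] [Fintype Q] [DecidableEq Q] {P : α × Q → ℝ}
    (hQ : ∀ q, 0 < law P Prod.snd q) (V : α → β) :
    condEntropy P (fun ω => V ω.1) Prod.snd =
      ∑ q, law P Prod.snd q * condEntropy (condLaw P q) V (fun _ => ()) := by
  have h1 : ∀ q b, law (condLaw P q) (fun a => (V a, ())) (b, ()) =
      law P (fun ω => (V ω.1, ω.2)) (b, q) / law P Prod.snd q := by
    intro q b
    have : law P (fun ω => (V ω.1, ω.2)) (b, q) = ∑ a with V a = b, P (a, q) := by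
      rw [law, sum_filter, Fintype.sum_prod_type, sum_filter]
      refine sum_congr rfl fun a _ => ?_
      by_cases h : V a = b <;> simp [h]
    rw [this, sum_div, law]
    refine sum_congr (by ext; simp) fun a _ => rfl
  have h2 : ∀ q, law (condLaw P q) (fun _ => ()) () = 1 := by
    intro q
    have : law (condLaw P q) (fun _ => ()) () = ∑ a, condLaw P q a := by simp [law]
    rw [this]
    simp only [condLaw]
    rw [← sum_div, ← law_snd, div_self (hQ q).ne']
  rw [condEntropy_eq_sum, Fintype.sum_prod_type_right, ← sum_neg_distrib]
  refine sum_congr rfl fun q _ => ?_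
  rw [condEntropy_eq_sum, mul_neg, mul_sum]
  congr 1
  refine sum_congr rfl fun a _ => ?_
  rw [h1, h2, div_one, condLaw, ← mul_assoc, mul_div_cancel₀ _ (hQ q).ne']

end Entropy

/-! ### Cardinality of the index set and of its congruence classes -/

section Blocks

theorem absLogFiber_nonneg {Ω α : Type*} [Fintype Ω] [DecidableEq α] (P : Ω → ℝ) (f : Ω → α) :
    0 ≤ absLogFiber P f :=
  sum_nonneg fun _ _ => abs_nonneg _

theorem fiberProb_unit {Ω : Type*} [Fintype Ω] {P : Ω → ℝ} (hP : ∑ ω, P ω = 1) (ω : Ω) :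
    fiberProb P (fun _ => ()) ω = P ω := by
  simp [fiberProb, law, hP]

open Classical in
/-- The cardinality of the set of typical sequences, and of its subset of sequences with
a prescribed image under `f s`. -/
theorem exists_typical_card_bounds {Ω β : Type*} [Fintype Ω] [DecidableEq Ω] [Fintype β]
    [DecidableEq β] {P : Ω → ℝ} (hP : P ∈ stdSimplex ℝ Ω) (f : ℕ → Ω → β) (r : ℕ) :
    ∃ C : ℝ, 0 ≤ C ∧ ∀ ε : ℝ, 0 < ε → ∃ N : ℕ, ∀ k : ℕ, N < k →
      0 < (univ.filter fun v : Fin k → Ω => IsTypical P ε v).card ∧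
      ((univ.filter fun v : Fin k → Ω => IsTypical P ε v).card : ℝ) ≤
        (2 : ℝ) ^ (k * (condEntropy P (fun a => a) (fun _ => ()) + ε * C)) ∧
      ∀ s, s ≤ r → ∀ z : Fin k → β,
        ((univ.filter fun v : Fin k → Ω => IsTypical P ε v ∧
          ∀ i, f s (v i) = z i).card : ℝ) ≤
        (univ.filter fun v : Fin k → Ω => IsTypical P ε v).card *
          (2 : ℝ) ^ (k * (-condEntropy P (f s) (fun _ => ()) + ε * C) + 1) := by
  set M : ℕ → ℝ := fun s => absLogFiber P fun a => (f s a, ()) with hM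
  set M₀ := absLogFiber P fun _ => () with hM₀
  have hM0 : 0 ≤ M₀ := absLogFiber_nonneg _ _
  have hMs : ∀ s, 0 ≤ M s := fun s => absLogFiber_nonneg _ _
  have hsum : 0 ≤ ∑ s ∈ range (r + 1), M s := sum_nonneg fun s _ => hMs s
  refine ⟨M₀ + ∑ s ∈ range (r + 1), M s, add_nonneg hM0 hsum, fun ε hε => ?_⟩
  obtain ⟨N, hN⟩ := exists_sum_not_isTypical_lt hP hε (one_half_pos (α := ℝ))
  refine ⟨N, fun k hk => ?_⟩
  set S := univ.filter fun v : Fin k → Ω => IsTypical P ε v with hS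
  have hSt : ∀ v ∈ S, IsTypical P ε v := fun v hv => (mem_filter.1 hv).2
  have hhalf : 1 / 2 < ∑ v ∈ S, ∏ i, P (v i) := by
    have h1 := sum_filter_add_sum_filter_not univ
      (fun v : Fin k → Ω => IsTypical P ε v) fun v => ∏ i, P (v i)
    rw [sum_prod_pmf hP.2] at h1
    have := hN k hk
    rw [hS]
    linarith
  have hmean := meanLogFiber_unit hP.1
  have hlow : 1 / 2 < (S.card : ℝ) *
      (2 : ℝ) ^ (k * (meanLogFiber P (fun _ => ()) + ε * M₀)) := by
    refine hhalf.trans_le (le_trans (le_of_eq ?_)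
      (sum_prod_fiberProb_le_card_mul hP.1 (fun _ => ()) hε.le S hSt))
    simp_rw [fiberProb_unit hP.2]
  refine ⟨?_, ?_, fun s hs z => ?_⟩
  · rcases Nat.eq_zero_or_pos S.card with h | h
    · rw [h] at hlow; norm_num at hlow
    · exact h
  · refine (card_typical_fiber_le hP.1 (fun _ => ()) hε.le (fun _ => ()) S hSt
      fun _ _ _ => rfl).trans (Real.rpow_le_rpow_of_exponent_le (by norm_num) ?_)
    rw [hmean, neg_neg]
    gcongr
    linarith
  · have h1 := card_typical_fiber_le hP.1 (fun a => (f s a, ())) hε.le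
      (fun i => (z i, ())) (univ.filter fun v : Fin k → Ω => IsTypical P ε v ∧
          ∀ i, f s (v i) = z i) (fun v hv => (mem_filter.1 hv).2.1)
      (fun v hv i => by rw [(mem_filter.1 hv).2.2 i])
    have hchain := meanLogFiber_eq_add hP.1 (f s) fun _ => ()
    have hle : M s ≤ ∑ s ∈ range (r + 1), M s :=
      single_le_sum (fun s _ => hMs s) (mem_range.2 (Nat.lt_succ_of_le hs))
    refine h1.trans ?_
    set m := meanLogFiber P fun _ => ()
    set ms := meanLogFiber P fun a => (f s a, ())
    -- The lower bound on `S.card` turns the absolute count into a proportion of `S`. Its constant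
    -- `1 / 2` is the `+ 1` in the exponent.
    calc (2 : ℝ) ^ (k * (-ms + ε * M s))
        = 1 / 2 * (2 : ℝ) ^ (k * (-ms + ε * M s) + 1) := by
          rw [Real.rpow_add two_pos, Real.rpow_one]; ring
      _ ≤ (S.card * (2 : ℝ) ^ (k * (m + ε * M₀))) * (2 : ℝ) ^ (k * (-ms + ε * M s) + 1) := by
          gcongr
      _ = S.card * (2 : ℝ) ^ (k * (m + ε * M₀) + (k * (-ms + ε * M s) + 1)) := by
          rw [mul_assoc, ← Real.rpow_add two_pos]
      _ ≤ _ := by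
          refine mul_le_mul_of_nonneg_left
            (Real.rpow_le_rpow_of_exponent_le (by norm_num) ?_) (Nat.cast_nonneg _)
          have : (k : ℝ) * (m + ε * M₀) + (k * (-ms + ε * M s) + 1) =
              k * (-condEntropy P (f s) (fun _ => ()) + ε * (M₀ + M s)) + 1 := by
            rw [hchain]; ring
          rw [this]
          gcongr

theorem card_filter_sigma_pi {Q Z : Type*} [Fintype Q] [DecidableEq Q] [Fintype Z] (k : Q → ℕ)
    (pr : ∀ q, (Fin (k q) → Z) → Prop) [∀ q, DecidablePred (pr q)]
    [DecidablePred fun u : (Σ q, Fin (k q)) → Z => ∀ q, pr q fun j => u ⟨q, j⟩] :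
    (univ.filter fun u : (Σ q, Fin (k q)) → Z => ∀ q, pr q fun j => u ⟨q, j⟩).card =
      ∏ q, (univ.filter (pr q)).card := by
  rw [← Fintype.card_piFinset]
  refine card_equiv (Equiv.piCurry fun _ _ => Z) fun u => ?_
  simp only [mem_filter, mem_univ, true_and, Fintype.mem_piFinset]
  rfl

open Classical in
/-- The cardinality of the index set, and of its subset of vectors that agree with a given one
modulo `p ^ s`. -/
theorem exists_indexSet_card_bounds {p r : ℕ} [Fact p.Prime] {Q : Type*} [Fintype Q]
    [DecidableEq Q] {P : ZMod (p ^ r) × Q → ℝ} (hP : ∀ ω, 0 ≤ P ω)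
    (hQ : ∀ q, 0 < law P Prod.snd q) {c : ℝ} (hc : 0 < c) :
    ∃ C : ℝ, 0 ≤ C ∧ ∀ ε : ℝ, 0 < ε → ∃ (N : ℕ) (K : ℝ), 0 ≤ K ∧ ∀ n : ℕ, N < n →
      ∀ k : Q → ℕ, (∀ q, |(k q : ℝ) - law P Prod.snd q * (c * n)| < 1) →
      0 < (univ.filter (· ∈ indexSet P ε k)).card ∧
      ((univ.filter (· ∈ indexSet P ε k)).card : ℝ) ≤
        (2 : ℝ) ^ (n * (c * condEntropy P Prod.fst Prod.snd + ε * C) + K) ∧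
      ∀ s, s ≤ r → ∀ u : (Σ q, Fin (k q)) → ZMod (p ^ r),
        (((univ.filter (· ∈ indexSet P ε k)).filter fun u' => ∀ i,
          cosetRep p r s (u' i) = cosetRep p r s (u i)).card : ℝ) ≤
        (univ.filter (· ∈ indexSet P ε k)).card *
          (2 : ℝ) ^ (n * (-(c * condEntropy P (fun ω => cosetRep p r s ω.1) Prod.snd) +
            ε * C) + K) := by
  choose C hC0 hC using fun q => exists_typical_card_bounds
    (condLaw_mem_stdSimplex hP (hQ q)) (cosetRep p r) r
  refine ⟨c * ∑ q, law P Prod.snd q * C q,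
    mul_nonneg hc.le (sum_nonneg fun q _ => mul_nonneg (hQ q).le (hC0 q)), fun ε hε => ?_⟩
  choose N hN using fun q => hC q ε hε
  set a : Q → ℝ := fun q => condEntropy (condLaw P q) (fun a => a) (fun _ => ()) + ε * C q
    with ha
  set b : ℕ → Q → ℝ := fun s q =>
    -condEntropy (condLaw P q) (cosetRep p r s) (fun _ => ()) + ε * C q with hb
  -- Beyond `N'` the target length `P_Q(q) c n` exceeds `N q + 1`, so rounding by less than 1 still
  -- leaves `k q > N q`.
  obtain ⟨N', hN'⟩ : ∃ N' : ℕ, ∀ q, (N q + 1 : ℝ) / (law P Prod.snd q * c) < N' := by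
    choose F hF using fun q => exists_nat_gt ((N q + 1 : ℝ) / (law P Prod.snd q * c))
    refine ⟨∑ q, F q, fun q => (hF q).trans_le ?_⟩
    exact_mod_cast single_le_sum (f := F) (fun _ _ => Nat.zero_le _) (mem_univ q)
  have hround : ∀ (n : ℕ) (k : Q → ℕ), (∀ q, |(k q : ℝ) - law P Prod.snd q * (c * n)| < 1) →
      ∀ x : Q → ℝ, ∑ q, k q * x q ≤ n * (c * ∑ q, law P Prod.snd q * x q) + ∑ q, |x q| := by
    intro n k hk x
    rw [mul_sum, mul_sum, ← sum_add_distrib]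
    refine sum_le_sum fun q _ => ?_
    have h1 : ((k q : ℝ) - law P Prod.snd q * (c * n)) * x q ≤ |x q| := by
      refine (le_abs_self _).trans ?_
      rw [abs_mul]
      exact mul_le_of_le_one_left (abs_nonneg _) (hk q).le
    linarith
  -- `K` collects the rounding errors of all exponents, together with one factor of 2 per block.
  set K : ℝ := ∑ q, |a q| + ∑ s ∈ range (r + 1), ∑ q, |b s q| + Fintype.card Q with hK
  have hKa : 0 ≤ ∑ q, |a q| := sum_nonneg fun q _ => abs_nonneg _
  have hKb : ∀ s ∈ range (r + 1), 0 ≤ ∑ q, |b s q| := fun s _ =>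
    sum_nonneg fun q _ => abs_nonneg _
  have hKb' := sum_nonneg hKb
  refine ⟨N', K, by positivity, fun n hn k hk => ?_⟩
  have hkN : ∀ q, N q < k q := by
    intro q
    have h1 := (hN' q).trans (Nat.cast_lt.2 hn : (N' : ℝ) < n)
    rw [div_lt_iff₀ (mul_pos (hQ q) hc)] at h1
    have h2 := (abs_lt.1 (hk q)).1
    have : (N q : ℝ) < k q := by linarith
    exact_mod_cast this
  have hcardU : (univ.filter (· ∈ indexSet P ε k)).card =
      ∏ q, (univ.filter fun v : Fin (k q) → ZMod (p ^ r) =>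
        IsTypical (condLaw P q) ε v).card := by
    rw [← card_filter_sigma_pi k fun q v => IsTypical (condLaw P q) ε v]
    congr 1
    ext u
    simp only [mem_filter, mem_univ, true_and]
    rfl
  refine ⟨?_, ?_, fun s hs u => ?_⟩
  · rw [hcardU]
    exact prod_pos fun q _ => (hN q (k q) (hkN q)).1
  · rw [hcardU, Nat.cast_prod]
    calc _ ≤ ∏ q, (2 : ℝ) ^ (k q * a q) :=
          prod_le_prod (fun _ _ => Nat.cast_nonneg _) fun q _ => (hN q (k q) (hkN q)).2.1
      _ = (2 : ℝ) ^ ∑ q, k q * a q := (Real.rpow_sum_of_pos two_pos _ _).symm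
      _ ≤ _ := by
          refine Real.rpow_le_rpow_of_exponent_le (by norm_num) ((hround n k hk a).trans ?_)
          have h1 : ∑ q, law P Prod.snd q * a q = condEntropy P Prod.fst Prod.snd +
              ε * ∑ q, law P Prod.snd q * C q := by
            rw [condEntropy_eq_sum_condLaw hQ fun a => a, mul_sum, ← sum_add_distrib]
            exact sum_congr rfl fun q _ => by simp only [ha]; ring
          rw [h1, hK]
          have : (0 : ℝ) ≤ Fintype.card Q := Nat.cast_nonneg _
          linarith
  · have hcardA : ((univ.filter (· ∈ indexSet P ε k)).filter fun u' => ∀ i,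
          cosetRep p r s (u' i) = cosetRep p r s (u i)).card =
        ∏ q, (univ.filter fun v : Fin (k q) → ZMod (p ^ r) =>
          IsTypical (condLaw P q) ε v ∧
            ∀ j, cosetRep p r s (v j) = cosetRep p r s (u ⟨q, j⟩)).card := by
      rw [← card_filter_sigma_pi k fun q v => IsTypical (condLaw P q) ε v ∧
        ∀ j, cosetRep p r s (v j) = cosetRep p r s (u ⟨q, j⟩), filter_filter]
      congr 1
      ext u'
      simp only [mem_filter, mem_univ, true_and, indexSet, Set.mem_ofPred_eq, Sigma.forall,
        forall_and]
    rw [hcardA, hcardU, Nat.cast_prod, Nat.cast_prod]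
    calc _ ≤ ∏ q, (((univ.filter fun v : Fin (k q) → ZMod (p ^ r) =>
            IsTypical (condLaw P q) ε v).card : ℝ) * (2 : ℝ) ^ (k q * b s q + 1)) :=
          prod_le_prod (fun _ _ => Nat.cast_nonneg _) fun q _ =>
            (hN q (k q) (hkN q)).2.2 s hs _
      _ = (∏ q, ((univ.filter fun v : Fin (k q) → ZMod (p ^ r) =>
            IsTypical (condLaw P q) ε v).card : ℝ)) *
            (2 : ℝ) ^ (∑ q, k q * b s q + Fintype.card Q) := by
          rw [prod_mul_distrib, ← Real.rpow_sum_of_pos two_pos, sum_add_distrib]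
          simp
      _ ≤ _ := by
          refine mul_le_mul_of_nonneg_left
            (Real.rpow_le_rpow_of_exponent_le (by norm_num) ?_)
            (prod_nonneg fun _ _ => Nat.cast_nonneg _)
          have h1 : ∑ q, law P Prod.snd q * b s q =
              -condEntropy P (fun ω => cosetRep p r s ω.1) Prod.snd +
              ε * ∑ q, law P Prod.snd q * C q := by
            rw [condEntropy_eq_sum_condLaw hQ (cosetRep p r s), mul_sum, ← sum_neg_distrib,
              ← sum_add_distrib]
            exact sum_congr rfl fun q _ => by simp only [hb]; ring
          have h2 := hround n k hk (b s)
          have h3 := single_le_sum hKb (mem_range.2 (Nat.lt_succ_of_le hs))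
          rw [h1] at h2
          rw [hK]
          linarith

end Blocks

/-! ### Sequences jointly typical with a source sequence -/

open Classical in
/-- The sequences that are jointly typical with `x`. -/
noncomputable def typicalSlice {X Z : Type*} [Fintype X] [DecidableEq X] [Fintype Z]
    [DecidableEq Z] (P : X × Z → ℝ) (ε : ℝ) {n : ℕ} (x : Fin n → X) : Finset (Fin n → Z) :=
  univ.filter fun y => JointlyTypical P ε x y

theorem mem_typicalSlice {X Z : Type*} [Fintype X] [DecidableEq X] [Fintype Z]
    [DecidableEq Z] {P : X × Z → ℝ} {ε : ℝ} {n : ℕ} {x : Fin n → X} {y : Fin n → Z} :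
    y ∈ typicalSlice P ε x ↔ JointlyTypical P ε x y := by
  simp [typicalSlice]

theorem sum_prod_pair {X Z : Type*} [DecidableEq X] [Fintype X] [Fintype Z] (P : X × Z → ℝ)
    {n : ℕ} (x : Fin n → X) :
    ∑ y : Fin n → Z, ∏ i, P (x i, y i) = ∏ i, law P Prod.fst (x i) := by
  simp only [law_fst]
  rw [prod_univ_sum (fun _ => univ) fun i z => P (x i, z), Fintype.piFinset_univ]

theorem sum_pair_pi {X Z M : Type*} [Fintype X] [Fintype Z] [AddCommMonoid M] {n : ℕ}
    (F : (Fin n → X × Z) → M) :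
    ∑ w, F w = ∑ x : Fin n → X, ∑ y : Fin n → Z, F fun i => (x i, y i) := by
  rw [← (Equiv.arrowProdEquivProdArrow (Fin n) (fun _ => X) (fun _ => Z)).symm.sum_comp,
    Fintype.sum_prod_type]
  rfl

/-- If, given `x`, a jointly typical continuation has conditional probability more than one half,
then only a small part of the slice of `x` lies over a given sequence under `f`. -/
theorem card_slice_fiber_le {X Z β : Type*} [Fintype X] [DecidableEq X] [Fintype Z]
    [DecidableEq Z] [Fintype β] [DecidableEq β] {P : X × Z → ℝ} (hP : ∀ ω, 0 ≤ P ω) {ε : ℝ}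
    (hε : 0 ≤ ε) {n : ℕ} {x : Fin n → X} (f : Z → β)
    (hx : 0 < ∏ i, law P Prod.fst (x i))
    (hhalf : (∏ i, law P Prod.fst (x i)) / 2 ≤
      ∑ y ∈ typicalSlice P ε x, ∏ i, P (x i, y i)) (z : Fin n → β) :
    (((typicalSlice P ε x).filter fun y => ∀ i, f (y i) = z i).card : ℝ) ≤
      (typicalSlice P ε x).card * (2 : ℝ) ^ (n * (-condEntropy P (fun ω => f ω.2) Prod.fst +
        ε * (absLogFiber P Prod.fst + absLogFiber P fun ω => (f ω.2, ω.1))) + 1) := by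
  set m := meanLogFiber P Prod.fst with hm
  set ms := meanLogFiber P fun ω => (f ω.2, ω.1) with hms
  set M₀ := absLogFiber P Prod.fst
  set M := absLogFiber P fun ω => (f ω.2, ω.1)
  have hchain : m = ms - condEntropy P (fun ω => f ω.2) Prod.fst :=
    meanLogFiber_eq_add hP (fun ω => f ω.2) Prod.fst
  set e : (Fin n → Z) ↪ (Fin n → X × Z) := ⟨fun y i => (x i, y i), fun y y' h => by
    funext i; exact congrArg Prod.snd (congrFun h i)⟩ with he
  have hT : ∀ w ∈ (typicalSlice P ε x).map e, IsTypical P ε w := by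
    intro w hw
    obtain ⟨y, hy, rfl⟩ := mem_map.1 hw
    exact mem_typicalSlice.1 hy
  have hlow : 1 / 2 ≤ ((typicalSlice P ε x).card : ℝ) * (2 : ℝ) ^ (n * (m + ε * M₀)) := by
    have h1 := sum_prod_fiberProb_le_card_mul hP Prod.fst hε _ hT
    rw [card_map, sum_map] at h1
    refine le_trans ?_ h1
    have h2 : ∀ y : Fin n → Z, ∏ i, fiberProb P Prod.fst (e y i) =
        (∏ i, P (x i, y i)) / ∏ i, law P Prod.fst (x i) := by
      intro y
      rw [← prod_div_distrib]
      rfl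
    simp only [h2]
    rw [← sum_div, le_div_iff₀ hx]
    linarith
  have hup : (((typicalSlice P ε x).filter fun y => ∀ i, f (y i) = z i).card : ℝ) ≤
      (2 : ℝ) ^ (n * (-ms + ε * M)) := by
    have h1 := card_typical_fiber_le hP (fun ω => (f ω.2, ω.1)) hε (fun i => (z i, x i))
      (((typicalSlice P ε x).filter fun y => ∀ i, f (y i) = z i).map e) ?_ ?_
    · rwa [card_map] at h1
    · intro w hw
      exact hT w (map_subset_map.2 (filter_subset _ _) hw)
    · intro w hw i
      obtain ⟨y, hy, rfl⟩ := mem_map.1 hw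
      exact Prod.ext ((mem_filter.1 hy).2 i) rfl
  calc _ ≤ (2 : ℝ) ^ (n * (-ms + ε * M)) := hup
    _ = 1 / 2 * (2 : ℝ) ^ (n * (-ms + ε * M) + 1) := by
        rw [Real.rpow_add two_pos, Real.rpow_one]; ring
    _ ≤ ((typicalSlice P ε x).card * (2 : ℝ) ^ (n * (m + ε * M₀))) *
          (2 : ℝ) ^ (n * (-ms + ε * M) + 1) := by gcongr
    _ = _ := by
        rw [mul_assoc, ← Real.rpow_add two_pos]
        congr 2
        rw [hchain]
        ring

open Classical in
/-- With high probability the source sequence has jointly typical continuations, of which only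
few agree modulo `p ^ s`. -/
theorem exists_slice_card_bounds {p r : ℕ} [Fact p.Prime] {X : Type*} [Fintype X]
    [DecidableEq X] {P : X × ZMod (p ^ r) → ℝ} (hP : P ∈ stdSimplex ℝ (X × ZMod (p ^ r))) :
    ∃ C : ℝ, 0 ≤ C ∧ ∀ ε : ℝ, 0 < ε → ∀ δ : ℝ, 0 < δ → ∃ N : ℕ, ∀ n : ℕ, N < n →
      ∑ x : Fin n → X with ¬ ((typicalSlice P ε x).Nonempty ∧
        ∀ s, s ≤ r → ∀ z : Fin n → ZMod (p ^ r),
          (((typicalSlice P ε x).filter fun y => ∀ i, cosetRep p r s (y i) = z i).card : ℝ) ≤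
          (typicalSlice P ε x).card * (2 : ℝ) ^
            (n * (-condEntropy P (fun ω => cosetRep p r s ω.2) Prod.fst + ε * C) + 1)),
        ∏ i, law P Prod.fst (x i) < δ := by
  set M : ℕ → ℝ := fun s => absLogFiber P fun ω => (cosetRep p r s ω.2, ω.1) with hM
  set M₀ := absLogFiber P Prod.fst with hM₀
  have hM0 : 0 ≤ M₀ := absLogFiber_nonneg _ _
  have hMs : ∀ s, 0 ≤ M s := fun s => absLogFiber_nonneg _ _
  have hsum : 0 ≤ ∑ s ∈ range (r + 1), M s := sum_nonneg fun s _ => hMs s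
  refine ⟨M₀ + ∑ s ∈ range (r + 1), M s, add_nonneg hM0 hsum, fun ε hε δ hδ => ?_⟩
  obtain ⟨N, hN⟩ := exists_sum_not_isTypical_lt hP hε (half_pos hδ)
  refine ⟨N, fun n hn => ?_⟩
  have hbad := hN n hn
  rw [sum_filter, sum_pair_pi] at hbad
  have hnn : ∀ (x : Fin n → X) (y : Fin n → ZMod (p ^ r)), 0 ≤ ∏ i, P (x i, y i) :=
    fun x y => prod_nonneg fun i _ => hP.1 _
  -- `D x` is the probability of `x` together with an atypical continuation. The law of large
  -- numbers for the pair gives total mass below `δ / 2`.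
  set D : (Fin n → X) → ℝ := fun x => ∑ y : Fin n → ZMod (p ^ r),
    if ¬ IsTypical P ε (fun i => (x i, y i)) then ∏ i, P (x i, y i) else 0 with hD
  have hD0 : ∀ x, 0 ≤ D x := fun x => sum_nonneg fun y _ => by
    split_ifs
    · exact le_rfl
    · exact hnn x y
  have hsplit : ∀ x, D x + ∑ y ∈ typicalSlice P ε x, ∏ i, P (x i, y i) =
      ∏ i, law P Prod.fst (x i) := by
    intro x
    rw [← sum_prod_pair, add_comm, hD, typicalSlice, sum_filter, ← sum_add_distrib]
    refine sum_congr rfl fun y _ => ?_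
    by_cases h : IsTypical P ε fun i => (x i, y i)
    · simp [JointlyTypical, h]
    · simp [JointlyTypical, h]
  have hstep : ∀ x : Fin n → X, D x < (∏ i, law P Prod.fst (x i)) / 2 →
      ((typicalSlice P ε x).Nonempty ∧
        ∀ s, s ≤ r → ∀ z : Fin n → ZMod (p ^ r),
          (((typicalSlice P ε x).filter fun y => ∀ i, cosetRep p r s (y i) = z i).card : ℝ) ≤
          (typicalSlice P ε x).card * (2 : ℝ) ^
            (n * (-condEntropy P (fun ω => cosetRep p r s ω.2) Prod.fst +
              ε * (M₀ + ∑ s ∈ range (r + 1), M s)) + 1)) := by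
    intro x hx
    have hpos : 0 < ∏ i, law P Prod.fst (x i) := by linarith [hD0 x]
    have hhalf : (∏ i, law P Prod.fst (x i)) / 2 ≤
        ∑ y ∈ typicalSlice P ε x, ∏ i, P (x i, y i) := by linarith [hsplit x]
    refine ⟨?_, fun s hs z => ?_⟩
    · by_contra h
      rw [not_nonempty_iff_eq_empty] at h
      rw [h, sum_empty] at hhalf
      linarith
    · have h1 := card_slice_fiber_le hP.1 hε.le (cosetRep p r s) hpos hhalf z
      have hle : M s ≤ ∑ s ∈ range (r + 1), M s :=
        single_le_sum (fun s _ => hMs s) (mem_range.2 (Nat.lt_succ_of_le hs))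
      refine le_trans (le_of_eq (by congr)) (h1.trans ?_)
      refine mul_le_mul_of_nonneg_left
        (Real.rpow_le_rpow_of_exponent_le (by norm_num) ?_) (Nat.cast_nonneg _)
      gcongr
  -- Markov's inequality: a bad `x` loses at least half its probability to atypical continuations,
  -- so its weight is at most `2 * D x`.
  calc _ ≤ ∑ x : Fin n → X, 2 * D x := by
        rw [sum_filter]
        refine sum_le_sum fun x _ => ?_
        split_ifs with h
        · linarith [hD0 x]
        · have := not_lt.1 (mt (hstep x) h)
          linarith
    _ < δ := by rw [← mul_sum]; linarith

/-! ### Covering probability, rates and the choice of constants -/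

open Classical in
/-- The covering probability in terms of the probabilities, given the source sequence, that the
code misses the slice of jointly typical sequences. -/
theorem coverProb_eq {m : ℕ} [NeZero m] {Q X : Type*} [Fintype Q] [DecidableEq Q] [Fintype X]
    [DecidableEq X] (PUQ : ZMod m × Q → ℝ) {PXX : X × ZMod m → ℝ} (hPXX : ∑ ω, PXX ω = 1)
    (ε : ℝ) (k : Q → ℕ) (n : ℕ) :
    coverProb PUQ PXX ε k n = 1 - ∑ x : Fin n → X, (∏ i, law PXX Prod.fst (x i)) *
      (((univ.filter fun ω : Matrix (Σ q, Fin (k q)) (Fin n) (ZMod m) × (Fin n → ZMod m) =>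
        ∀ u ∈ univ.filter (· ∈ indexSet PUQ ε k),
          Matrix.vecMul u ω.1 + ω.2 ∉ typicalSlice PXX ε x).card : ℝ) /
        (Fintype.card (Matrix (Σ q, Fin (k q)) (Fin n) (ZMod m)) *
          Fintype.card (Fin n → ZMod m))) := by
  set M : ℝ := (Fintype.card (Matrix (Σ q, Fin (k q)) (Fin n) (ZMod m)) : ℝ) with hM
  set V : ℝ := (Fintype.card (Fin n → ZMod m) : ℝ) with hV
  have hM0 : 0 < M := by
    rw [hM]
    exact_mod_cast Fintype.card_pos (α := Matrix (Σ q, Fin (k q)) (Fin n) (ZMod m))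
  have hV0 : 0 < V := by
    rw [hV]
    exact_mod_cast Fintype.card_pos (α := Fin n → ZMod m)
  have hone : ∑ x : Fin n → X, ∏ i, law PXX Prod.fst (x i) = 1 := by
    refine sum_prod_pmf ?_ n
    simp only [law_fst]
    rw [← hPXX, Fintype.sum_prod_type]
  rw [← hone, ← sum_sub_distrib, coverProb, Fintype.sum_prod_type]
  refine sum_congr rfl fun x _ => ?_
  set S := univ.filter fun ω : Matrix (Σ q, Fin (k q)) (Fin n) (ZMod m) × (Fin n → ZMod m) =>
        ∀ u ∈ univ.filter (· ∈ indexSet PUQ ε k),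
          Matrix.vecMul u ω.1 + ω.2 ∉ typicalSlice PXX ε x with hS
  set π := ∏ i, law PXX Prod.fst (x i) with hπ
  have hterm : ∀ ω : Matrix (Σ q, Fin (k q)) (Fin n) (ZMod m) × (Fin n → ZMod m),
      Set.indicator {ω | ∃ y ∈ code PUQ ε k ω.2.1 ω.2.2, JointlyTypical PXX ε ω.1 y}
        (ensembleLaw (law PXX Prod.fst) k n) (x, ω) = if ω ∈ S then 0 else π / (M * V) := by
    intro ω
    have hmem : (x, ω) ∈ {ω : (Fin n → X) × Matrix (Σ q, Fin (k q)) (Fin n) (ZMod m) ×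
        (Fin n → ZMod m) | ∃ y ∈ code PUQ ε k ω.2.1 ω.2.2, JointlyTypical PXX ε ω.1 y} ↔
        ω ∉ S := by
      simp only [hS, mem_filter, mem_univ, true_and, not_forall, not_not, mem_typicalSlice]
      constructor
      · rintro ⟨y, ⟨u, hu, rfl⟩, hy⟩
        exact ⟨u, hu, hy⟩
      · rintro ⟨u, hu, hy⟩
        exact ⟨_, ⟨u, hu, rfl⟩, hy⟩
    rw [Set.indicator_apply]
    by_cases h : ω ∈ S
    · rw [if_neg (fun h' => hmem.1 h' h), if_pos h]
    · rw [if_pos (hmem.2 h), if_neg h, ensembleLaw, ← hM, ← hV, ← hπ]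
      field_simp
  rw [sum_congr rfl fun ω _ => hterm ω]
  have h1 : ∑ ω : Matrix (Σ q, Fin (k q)) (Fin n) (ZMod m) × (Fin n → ZMod m),
      (if ω ∈ S then 0 else π / (M * V)) + ∑ ω : Matrix (Σ q, Fin (k q)) (Fin n) (ZMod m) ×
        (Fin n → ZMod m), (if ω ∈ S then π / (M * V) else 0) = π := by
    rw [← sum_add_distrib]
    have : ∀ ω, ((if ω ∈ S then 0 else π / (M * V)) + if ω ∈ S then π / (M * V) else 0) =
        π / (M * V) := fun ω => by split_ifs <;> simp
    rw [sum_congr rfl fun ω _ => this ω, sum_const, card_univ, Fintype.card_prod, nsmul_eq_mul,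
      Nat.cast_mul, ← hM, ← hV]
    field_simp
  rw [eq_sub_iff_add_eq]
  refine Eq.trans ?_ h1
  congr 1
  rw [sum_ite_mem, univ_inter, sum_const, nsmul_eq_mul]
  ring

theorem cosetRep_self {p r : ℕ} [NeZero (p ^ r)] (a : ZMod (p ^ r)) : cosetRep p r r a = a := by
  rw [cosetRep, Nat.mod_eq_of_lt (ZMod.val_lt a), ZMod.natCast_zmod_val]

theorem ncard_code_le {m : ℕ} [NeZero m] {Q : Type*} [Fintype Q] [DecidableEq Q]
    (P : ZMod m × Q → ℝ) (ε : ℝ) (k : Q → ℕ) {n : ℕ}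
    (G : Matrix (Σ q, Fin (k q)) (Fin n) (ZMod m)) (b : Fin n → ZMod m) :
    (code P ε k G b).ncard ≤ (indexSet P ε k).ncard := by
  have : code P ε k G b = (fun u => Matrix.vecMul u G + b) '' indexSet P ε k := by
    ext y
    constructor
    · rintro ⟨u, hu, rfl⟩
      exact ⟨u, hu, rfl⟩
    · rintro ⟨u, hu, rfl⟩
      exact ⟨u, hu, rfl⟩
  rw [this]
  exact Set.ncard_image_le (Set.toFinite _)

/-- The code is an image of the index set, so a rate condition on any realization implies the one on
the index set. -/
theorem rate_code_le {m : ℕ} [NeZero m] {Q : Type*} [Fintype Q] [DecidableEq Q]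
    (P : ZMod m × Q → ℝ) (ε : ℝ) (k : Q → ℕ) {n : ℕ}
    (G : Matrix (Σ q, Fin (k q)) (Fin n) (ZMod m)) (b : Fin n → ZMod m)
    (h : 0 < (indexSet P ε k).ncard) :
    rate n (code P ε k G b) ≤ rate n (indexSet P ε k) := by
  have hne : (code P ε k G b).Nonempty := by
    obtain ⟨u, hu⟩ := (Set.ncard_pos (Set.toFinite _)).1 h
    exact ⟨_, u, hu, rfl⟩
  have hpos : 0 < (code P ε k G b).ncard := (Set.ncard_pos (Set.toFinite _)).2 hne
  refine div_le_div_of_nonneg_right ?_ (Nat.cast_nonneg n)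
  exact Real.logb_le_logb_of_le (by norm_num) (by exact_mod_cast hpos)
    (by exact_mod_cast ncard_code_le P ε k G b)

/-- The rate condition makes the exponent of the second moment bound negative. -/
theorem exponent_le {H h L c ε C₁ C₂ ρ K n R : ℝ} (hH : 0 < H) (hh : 0 < h) (hn : 0 < n)
    (hε : 0 < ε) (hC₁ : 0 ≤ C₁) (hK : 0 ≤ K) (hρ : h / H ≤ ρ)
    (hR : H / h * (L + (C₁ + C₂ + ρ * C₁ + 1) * ε) < R)
    (hRle : R * n ≤ n * (c * H + ε * C₁) + K) :
    n * (-(c * h) + ε * C₁) + K + (n * (L + ε * C₂) + 1) ≤ -(n * ε) + (ρ * K + K + 1) := by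
  have h1 : L + (C₁ + C₂ + ρ * C₁ + 1) * ε ≤ h / H * R := by
    have := mul_lt_mul_of_pos_left hR (div_pos hh hH)
    have e : h / H * (H / h * (L + (C₁ + C₂ + ρ * C₁ + 1) * ε)) =
        L + (C₁ + C₂ + ρ * C₁ + 1) * ε := by field_simp
    linarith
  have h2 : n * (L + (C₁ + C₂ + ρ * C₁ + 1) * ε) ≤ n * (c * h) + h / H * (n * ε * C₁ + K) := by
    calc _ ≤ n * (h / H * R) := mul_le_mul_of_nonneg_left h1 hn.le
      _ = h / H * (R * n) := by ring
      _ ≤ h / H * (n * (c * H + ε * C₁) + K) :=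
          mul_le_mul_of_nonneg_left hRle (div_pos hh hH).le
      _ = _ := by field_simp; ring
  have h3 : h / H * (n * ε * C₁ + K) ≤ ρ * (n * ε * C₁ + K) :=
    mul_le_mul_of_nonneg_right hρ (by positivity)
  linarith

open Classical in
/-- The covering theorem when the rate is that of the index set. -/
theorem exists_coverProb_gt {p r : ℕ} [Fact p.Prime] (hr : 1 ≤ r)
    {Q X : Type*} [Fintype Q] [DecidableEq Q] [Fintype X] [DecidableEq X]
    {PUQ : ZMod (p ^ r) × Q → ℝ} (hPUQ : PUQ ∈ stdSimplex ℝ (ZMod (p ^ r) × Q))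
    (hQ : ∀ q, 0 < law PUQ Prod.snd q)
    (hU : ∀ s, 1 ≤ s → s ≤ r → 0 < condEntropy PUQ (fun ω => cosetRep p r s ω.1) Prod.snd)
    {PXX : X × ZMod (p ^ r) → ℝ} (hPXX : PXX ∈ stdSimplex ℝ (X × ZMod (p ^ r)))
    {c : ℝ} (hc : 0 < c) :
    ∃ C : ℝ, ∀ ε : ℝ, 0 < ε → ∀ δ : ℝ, 0 < δ → ∃ N : ℕ, ∀ n : ℕ, N < n →
      ∀ k : Q → ℕ, (∀ q, |(k q : ℝ) - law PUQ Prod.snd q * (c * n)| < 1) →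
        0 < (indexSet PUQ ε k).ncard ∧
        ((∀ s, 1 ≤ s → s ≤ r →
            coveringBound PUQ PXX (C * ε) s < rate n (indexSet PUQ ε k)) →
          1 - δ < coverProb PUQ PXX ε k n) := by
  have hp : p.Prime := Fact.out
  have hp0 : (0 : ℝ) < p := by exact_mod_cast hp.pos
  obtain ⟨C₁, hC₁, hI⟩ := exists_indexSet_card_bounds hPUQ.1 hQ hc
  obtain ⟨C₂, hC₂, hX⟩ := exists_slice_card_bounds hPXX
  set H := condEntropy PUQ Prod.fst Prod.snd with hHdef
  set h : ℕ → ℝ := fun s => condEntropy PUQ (fun ω => cosetRep p r s ω.1) Prod.snd with hh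
  -- This is the positivity hypothesis at `s = r`, where `[U]_r = U`.
  have hH : 0 < H := by
    have := hU r hr le_rfl
    simp only [cosetRep_self] at this
    exact this
  -- A bound on all the ratios `h s / H` at once; only its independence of `ε` and `n` matters.
  set ρ : ℝ := ∑ s ∈ Icc 1 r, h s / H with hρdef
  have hρ : ∀ s, 1 ≤ s → s ≤ r → h s / H ≤ ρ := fun s h1 h2 =>
    single_le_sum (f := fun s => h s / H)
      (fun s hs => (div_pos (hU s (mem_Icc.1 hs).1 (mem_Icc.1 hs).2) hH).le)
      (mem_Icc.2 ⟨h1, h2⟩)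
  -- `C₁` and `C₂` pay for the class counts in the index set and in the slice, and `ρ * C₁` for the
  -- rate possibly exceeding `c * H` by `ε * C₁`. The final 1 leaves a margin `n * ε` that beats all
  -- bounded terms.
  refine ⟨C₁ + C₂ + ρ * C₁ + 1, fun ε hε δ hδ => ?_⟩
  obtain ⟨N₁, K, hK, hI⟩ := hI ε hε
  obtain ⟨N₂, hX⟩ := hX ε hε (δ / 2) (half_pos hδ)
  have hr0 : (0 : ℝ) < r := by exact_mod_cast hr
  obtain ⟨N₃, hN₃⟩ := exists_nat_gt
    ((ρ * K + K + 1 - Real.logb 2 (δ / (2 * r))) / ε)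
  refine ⟨max N₁ (max N₂ N₃), fun n hn k hk => ?_⟩
  have hn1 : N₁ < n := (le_max_left _ _).trans_lt hn
  have hn2 : N₂ < n := ((le_max_left _ _).trans (le_max_right _ _)).trans_lt hn
  have hn3 : N₃ < n := ((le_max_right _ _).trans (le_max_right _ _)).trans_lt hn
  have hn0 : (0 : ℝ) < n := by exact_mod_cast (Nat.zero_le _).trans_lt hn
  obtain ⟨hUpos, hUle, hUs⟩ := hI n hn1 k hk
  set U := univ.filter (· ∈ indexSet PUQ ε k) with hUdef
  have hncard : (indexSet PUQ ε k).ncard = U.card := by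
    rw [← Set.ncard_coe_finset]
    congr 1
    ext u
    simp [hUdef]
  rw [hncard]
  refine ⟨hUpos, fun hrate => ?_⟩
  have hUc : (0 : ℝ) < U.card := by exact_mod_cast hUpos
  have hRle : rate n (indexSet PUQ ε k) * n ≤ n * (c * H + ε * C₁) + K := by
    rw [rate, hncard, div_mul_cancel₀ _ hn0.ne', Real.logb_le_iff_le_rpow (by norm_num) hUc]
    exact hUle
  set E : ℝ := -(n * ε) + (ρ * K + K + 1) with hE
  have hsmall : r * (2 : ℝ) ^ E < δ / 2 := by
    have h1 : E < Real.logb 2 (δ / (2 * r)) := by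
      have h2 := hN₃.trans (Nat.cast_lt.2 hn3 : (N₃ : ℝ) < n)
      rw [div_lt_iff₀ hε] at h2
      rw [hE]
      linarith
    rw [Real.lt_logb_iff_rpow_lt (by norm_num) (by positivity)] at h1
    calc r * (2 : ℝ) ^ E < r * (δ / (2 * r)) := by gcongr
      _ = δ / 2 := by field_simp
  rw [coverProb_eq PUQ hPXX.2]
  refine sub_lt_sub_left ?_ 1
  set good : (Fin n → X) → Prop := fun x => (typicalSlice PXX ε x).Nonempty ∧
        ∀ s, s ≤ r → ∀ z : Fin n → ZMod (p ^ r),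
          (((typicalSlice PXX ε x).filter fun y => ∀ i,
            cosetRep p r s (y i) = z i).card : ℝ) ≤
          (typicalSlice PXX ε x).card * (2 : ℝ) ^
            (n * (-condEntropy PXX (fun ω => cosetRep p r s ω.2) Prod.fst + ε * C₂) + 1)
    with hgood
  set miss : (Fin n → X) → ℝ := fun x =>
    ((univ.filter fun ω : Matrix (Σ q, Fin (k q)) (Fin n) (ZMod (p ^ r)) ×
        (Fin n → ZMod (p ^ r)) =>
        ∀ u ∈ U, Matrix.vecMul u ω.1 + ω.2 ∉ typicalSlice PXX ε x).card : ℝ) /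
        (Fintype.card (Matrix (Σ q, Fin (k q)) (Fin n) (ZMod (p ^ r))) *
          Fintype.card (Fin n → ZMod (p ^ r))) with hmiss
  have hmiss1 : ∀ x, miss x ≤ 1 := by
    intro x
    refine div_le_one_of_le₀ ?_ (by positivity)
    rw [← Nat.cast_mul, ← Fintype.card_prod]
    exact_mod_cast card_le_univ _
  have hmissg : ∀ x, good x → miss x ≤ r * (2 : ℝ) ^ E := by
    rintro x ⟨hTne, hTs⟩
    have hTc : (0 : ℝ) < (typicalSlice PXX ε x).card := by exact_mod_cast hTne.card_pos
    have key := card_miss_div_le U (typicalSlice PXX ε x) (card_pos.1 hUpos) hTne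
      (fun s => U.card * (2 : ℝ) ^ (n * (-(c * h s) + ε * C₁) + K))
      (fun s => (typicalSlice PXX ε x).card * (2 : ℝ) ^
        (n * (-condEntropy PXX (fun ω => cosetRep p r s ω.2) Prod.fst + ε * C₂) + 1))
      (fun s _ hs u _ => by convert hUs s hs u)
      (fun s _ hs y _ => by convert hTs s hs fun i => cosetRep p r s (y i))
    refine le_trans (le_of_eq ?_) (key.trans ?_)
    · simp only [hmiss]
    · calc _ ≤ ∑ _s ∈ Icc 1 r, (2 : ℝ) ^ E := by
            refine sum_le_sum fun s hs => ?_
            obtain ⟨hs1, hsr⟩ := mem_Icc.1 hs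
            have hps : (p : ℝ) ^ (s * n) = (2 : ℝ) ^ (n * Real.logb 2 ((p : ℝ) ^ s)) := by
              rw [mul_comm (n : ℝ), Real.rpow_mul two_pos.le,
                Real.rpow_logb two_pos (by norm_num) (by positivity), Real.rpow_natCast, pow_mul]
            rw [mul_div_cancel_left₀ _ hUc.ne', mul_div_cancel_left₀ _ hTc.ne', hps,
              ← Real.rpow_add two_pos, ← Real.rpow_add two_pos]
            refine Real.rpow_le_rpow_of_exponent_le (by norm_num) ?_
            have := exponent_le hH (hU s hs1 hsr) hn0 hε hC₁ hK (hρ s hs1 hsr)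
              (hrate s hs1 hsr) hRle
            simp only [hh]
            linarith
        _ = r * (2 : ℝ) ^ E := by simp
  have hπ0 : ∀ x : Fin n → X, 0 ≤ ∏ i, law PXX Prod.fst (x i) := fun x =>
    prod_nonneg fun i _ => law_nonneg hPXX.1 _ _
  have hone : ∑ x : Fin n → X, ∏ i, law PXX Prod.fst (x i) = 1 := by
    refine sum_prod_pmf ?_ n
    simp only [law_fst]
    rw [← hPXX.2, Fintype.sum_prod_type]
  -- Bad source sequences cost their probability, below `δ / 2`; good ones are missed with
  -- probability at most `r * 2 ^ E`, also below `δ / 2`.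
  calc ∑ x : Fin n → X, (∏ i, law PXX Prod.fst (x i)) * miss x
      ≤ ∑ x : Fin n → X, ((if ¬ good x then ∏ i, law PXX Prod.fst (x i) else 0) +
          (∏ i, law PXX Prod.fst (x i)) * (r * (2 : ℝ) ^ E)) := by
        refine sum_le_sum fun x _ => ?_
        by_cases hx : good x
        · rw [if_neg (not_not.2 hx), zero_add]
          exact mul_le_mul_of_nonneg_left (hmissg x hx) (hπ0 x)
        · rw [if_pos hx]
          have h1 := mul_le_of_le_one_right (hπ0 x) (hmiss1 x)
          have h2 : 0 ≤ (∏ i, law PXX Prod.fst (x i)) * (r * (2 : ℝ) ^ E) :=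
            mul_nonneg (hπ0 x) (by positivity)
          linarith
    _ = (∑ x : Fin n → X with ¬ good x, ∏ i, law PXX Prod.fst (x i)) + r * (2 : ℝ) ^ E := by
        rw [sum_add_distrib, ← sum_mul, hone, one_mul, sum_filter]
    _ < δ / 2 + δ / 2 := add_lt_add (hX n hn2) hsmall
    _ = δ := add_halves δ

end QGC

theorem mainTheorem6 (p r : ℕ) [Fact p.Prime] (hr : 1 ≤ r)
    {Q X : Type*} [Fintype Q] [DecidableEq Q] [Fintype X] [DecidableEq X]
    (PUQ : ZMod (p ^ r) × Q → ℝ) (hPUQ : PUQ ∈ stdSimplex ℝ (ZMod (p ^ r) × Q))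
    (hQ : ∀ q, 0 < QGC.law PUQ Prod.snd q)
    (hU : ∀ s, 1 ≤ s → s ≤ r →
      0 < QGC.condEntropy PUQ (fun ω => QGC.cosetRep p r s ω.1) Prod.snd)
    (PXX : X × ZMod (p ^ r) → ℝ) (hPXX : PXX ∈ stdSimplex ℝ (X × ZMod (p ^ r)))
    (c : ℝ) (hc : 0 < c) :
    ∃ η : ℝ → ℝ, Filter.Tendsto η (nhdsWithin 0 (Set.Ioi 0)) (nhds 0) ∧
      ∀ ε : ℝ, 0 < ε → ∀ δ : ℝ, 0 < δ → ∃ N : ℕ, ∀ n : ℕ, N < n →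
        ∀ k : Q → ℕ, (∀ q, |(k q : ℝ) - QGC.law PUQ Prod.snd q * (c * n)| < 1) →
          ((∀ s, 1 ≤ s → s ≤ r →
              QGC.coveringBound PUQ PXX (η ε) s < QGC.rate n (QGC.indexSet PUQ ε k)) →
            1 - δ < QGC.coverProb PUQ PXX ε k n) ∧
          (∀ (G : Matrix (Σ q, Fin (k q)) (Fin n) (ZMod (p ^ r))) (b : Fin n → ZMod (p ^ r)),
            (∀ s, 1 ≤ s → s ≤ r →
              QGC.coveringBound PUQ PXX (η ε) s < QGC.rate n (QGC.code PUQ ε k G b)) →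
            1 - δ < QGC.coverProb PUQ PXX ε k n) := by
  obtain ⟨C, hC⟩ := QGC.exists_coverProb_gt hr hPUQ hQ hU hPXX hc
  refine ⟨fun ε => C * ε, ?_, fun ε hε δ hδ => ?_⟩
  · have : Filter.Tendsto (fun ε : ℝ => C * ε) (nhds 0) (nhds (C * 0)) :=
      (continuous_const.mul continuous_id).tendsto 0
    rw [mul_zero] at this
    exact this.mono_left nhdsWithin_le_nhds
  · obtain ⟨N, hN⟩ := hC ε hε δ hδ
    refine ⟨N, fun n hn k hk => ?_⟩
    obtain ⟨hpos, hcover⟩ := hN n hn k hk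
    exact ⟨hcover, fun G b hG => hcover fun s h1 h2 =>
      (hG s h1 h2).trans_le (QGC.rate_code_le PUQ ε k G b hpos)⟩
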